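/- Let $a\ge b>0$ be constants. Consider the binary symmetric stochastic block model on $n$ nodes: the labels $x^*=(x_1,\dots,x_n)\in\{1,-1\}^n$ are i.i.d. and uniform; given the labels, each pair of nodes is joined by an edge independently, with probability $a\frac{\log n}{n}$ if their labels agree and $b\frac{\log n}{n}$ if they differ. In addition $K=K(n)$ features, each with $M$ possible outcomes, are observed at each node; given the labels, all features of all nodes are independent of each other and of the graph, and each feature at a node takes the value $m\in\{1,\dots,M\}$ with probability $\alpha_{+,m}$ if the label of the node is $1$ and $\alpha_{-,m}$ if it is $-1$. Here $M$ is fixed, all $\alpha_{\pm,m}$ are nonzero and independent of $n$, and $\sum_m\alpha_{+,m}=\sum_m\alpha_{-,m}=1$. An estimator is a function $\hat x$ of the graph and the side information with values in $\{1,-1\}^n$. Assume $K=o(\log n)$. Then: 1. If $(\sqrt a-\sqrt b)^2>2$, exact recovery of the two communities is possible: there are estimators $\hat x$ (one for each $n$) with $\mathbb P(\hat x\in\{x^*,-x^*\})\to1$ as $n\to\infty$. If moreover the features carry information ($\alpha_{+,m}\ne\alpha_{-,m}$ for some $m$, and $K\ge1$ for all large $n$), then the labels themselves can be recovered exactly: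 there are estimators with $\mathbb P(\hat x=x^*)\to1$. 2. If $(\sqrt a-\sqrt b)^2<2$, exact recovery is impossible: there is $\delta>0$ such that for all sufficiently large $n$ every estimator $\hat x$ satisfies $\mathbb P(\hat x\notin\{x^*,-x^*\})\ge\delta$ (hence also $\mathbb P(\hat x\ne x^*)\ge\delta$). Thus $(\sqrt a-\sqrt b)^2=2$ is the phase transition of exact recovery, exactly as without side information ($K=0$). -/

import Mathlib

open Filter Topology Asymptotics

/-- Community labels `1` and `-1` of `n` nodes (`ℤˣ = {1, -1}`). -/
abbrev SBMLabels (n : ℕ) : Type := Fin n → ℤˣ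

/-- Side information: `y i k` is the outcome, among `M`, of feature `k` at node `i`. -/
abbrev SBMSideInfo (n K M : ℕ) : Type := Fin n → Fin K → Fin M

/-- An estimator maps the observed graph and the side information to node labels. -/
abbrev SBMEstimator (n K M : ℕ) : Type :=
  SimpleGraph (Fin n) → SBMSideInfo n K M → SBMLabels n

/-- The edge probability `c * log n / n`, which is at most `1` for all large `n`;
for the remaining small `n` it is replaced by `1`. -/
noncomputable def sbmEdgeProb (c : ℝ) (n : ℕ) : ℝ :=
  min (c * Real.log n / n) 1

/-- The probability of an edge between nodes `i` and `j` when the labels are `x`. -/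
noncomputable def sbmPairProb (a b : ℝ) {n : ℕ} (x : SBMLabels n) (i j : Fin n) : ℝ :=
  if x i = x j then sbmEdgeProb a n else sbmEdgeProb b n

open Classical in
/-- The conditional probability of the graph `G` given the labels `x`:
each pair `i < j` is an edge independently of the others. -/
noncomputable def sbmGraphProb (a b : ℝ) {n : ℕ} (x : SBMLabels n)
    (G : SimpleGraph (Fin n)) : ℝ :=
  ∏ i : Fin n, ∏ j ∈ Finset.Ioi i,
    if G.Adj i j then sbmPairProb a b x i j else 1 - sbmPairProb a b x i j

/-- The conditional probability of the side information `y` given the labels `x`: all features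
of all nodes are independent, and `α s m` is the probability of outcome `m` under label `s`. -/
noncomputable def sbmSideProb {n K M : ℕ} (α : ℤˣ → Fin M → ℝ) (x : SBMLabels n)
    (y : SBMSideInfo n K M) : ℝ :=
  ∏ i : Fin n, ∏ k : Fin K, α (x i) (y i k)

/-- The joint probability of labels, graph and side information. The labels are independent and
uniform, and given the labels the graph and the side information are independent. -/
noncomputable def sbmJointProb (a b : ℝ) {n K M : ℕ} (α : ℤˣ → Fin M → ℝ)
    (x : SBMLabels n) (G : SimpleGraph (Fin n)) (y : SBMSideInfo n K M) : ℝ :=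
  (1 / 2 : ℝ) ^ n * sbmGraphProb a b x G * sbmSideProb α x y

open Classical in
/-- The probability of an event in the model with `n` nodes and `K` features. -/
noncomputable def sbmProb (a b : ℝ) (n K : ℕ) {M : ℕ} (α : ℤˣ → Fin M → ℝ)
    (S : SBMLabels n → SimpleGraph (Fin n) → SBMSideInfo n K M → Prop) : ℝ :=
  ∑ x : SBMLabels n, ∑ G : SimpleGraph (Fin n), ∑ y : SBMSideInfo n K M,
    if S x G y then sbmJointProb a b α x G y else 0

/-- Exact recovery of the communities, i.e. of the labels up to a global sign: some sequence of
estimators makes no error with probability tending to one. -/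
def SBMExactCommunityRecovery (a b : ℝ) (K : ℕ → ℕ) {M : ℕ} (α : ℤˣ → Fin M → ℝ) : Prop :=
  ∃ xhat : ∀ n : ℕ, SBMEstimator n (K n) M,
    Tendsto (fun n : ℕ => sbmProb a b n (K n) α
      (fun x G y => xhat n G y = x ∨ xhat n G y = -x)) atTop (𝓝 1)

/-- Exact recovery of the labels themselves, including the global sign. -/
def SBMExactLabelRecovery (a b : ℝ) (K : ℕ → ℕ) {M : ℕ} (α : ℤˣ → Fin M → ℝ) : Prop :=
  ∃ xhat : ∀ n : ℕ, SBMEstimator n (K n) M,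
    Tendsto (fun n : ℕ => sbmProb a b n (K n) α
      (fun x G y => xhat n G y = x)) atTop (𝓝 1)

/-- Every estimator, even of the labels only up to a global sign, fails with probability
bounded away from zero. -/
def SBMRecoveryFails (a b : ℝ) (K : ℕ → ℕ) {M : ℕ} (α : ℤˣ → Fin M → ℝ) : Prop :=
  ∃ δ : ℝ, 0 < δ ∧ ∀ᶠ n : ℕ in atTop, ∀ xhat : SBMEstimator n (K n) M,
    δ ≤ sbmProb a b n (K n) α
      (fun x G y => ¬ (xhat G y = x ∨ xhat G y = -x))

/-! Write `ρ = edgeAffinity a b n` and `φ = featureAffinity α` for the Bhattacharyya coefficients of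
one pair and one feature, and `c = (√a - √b) ^ 2 / 2`; then `ρ = 1 - (c + o(1)) log n / n`.

Possibility. A maximum a posteriori estimator outputs `z` instead of the truth `x` with probability
at most the sum of `√(P x) √(P z)` over the observations. By independence this is `2⁻ⁿ ρ ^ (k (n -
k)) φ ^ (K k)`, where `k` is the number of nodes at which `x` and `z` differ. The union bound
`sbmProb_map_estimator_le` weights these terms by `n.choose k`, and `tendsto_sum_choose_mul_exp`
shows that the sum over `0 < k < n` vanishes once `c > 1`. The term `k = n` is the global sign,
which only the features resolve, at cost `φ ^ (K n)`.

Impossibility. Let `Λᵢ` be the log-likelihood ratio of the graph for flipping node `i`, and let `T`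
be the sum of `exp (Λᵢ / 2)` over the nodes with `|Λᵢ| ≤ L`, where `L = ε log n`. With `μ = n ρ ^ (n
- 1)`, one has `E T ≥ μ / 2` (`le_sum_flipStatistic`) and `E T² ≤ 5 μ²` (`sum_flipStatistic_sq_le`).
If an estimator is right at `x`, it is wrong at every single flip of `x`, while the truncation and
the bounded feature ratios make `P x * T` at most `exp (L / 2) * A ^ K` times the total probability
of these flips. For `c < 1` and `K = o(log n)` that factor is at most `μ`, so `E[T; success] ≤ 2 μ
P(failure)`. On failure the second moment controls `T`, and `le_sbmProb_fail` concludes that failure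
has probability at least `1 / 28`. -/

/-! ### Graphs as families of independent pairs -/

/-- The pairs `i < j` of nodes, which are the potential edges of a graph. -/
abbrev NodePair (n : ℕ) : Type := {e : Fin n × Fin n // e.1 < e.2}

/-- A simple graph on `Fin n` is determined by the set of pairs `i < j` that are edges. -/
noncomputable def graphEquivPairs (n : ℕ) : SimpleGraph (Fin n) ≃ (NodePair n → Bool) := by
  classical
  exact
  { toFun := fun G e => decide (G.Adj e.1.1 e.1.2)
    invFun := fun f =>
      { Adj := fun i j => (∃ h : i < j, f ⟨(i, j), h⟩ = true) ∨ (∃ h : j < i, f ⟨(j, i), h⟩ = true)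
        symm := ⟨fun i j h => h.symm⟩
        loopless := ⟨fun i h => by
          rcases h with ⟨h, _⟩ | ⟨h, _⟩ <;> exact lt_irrefl _ h⟩ }
    left_inv := fun G => by
      ext i j
      simp only [decide_eq_true_eq]
      constructor
      · rintro (⟨_, h⟩ | ⟨_, h⟩)
        · exact h
        · exact h.symm
      · intro h
        rcases lt_or_gt_of_ne h.ne with h' | h'
        · exact Or.inl ⟨h', h⟩
        · exact Or.inr ⟨h', h.symm⟩
    right_inv := fun f => by
      ext ⟨⟨i, j⟩, h⟩
      have h' : i < j := h
      simp [h', not_lt_of_gt h'] }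

lemma graphEquivPairs_apply_eq_true {n : ℕ} (G : SimpleGraph (Fin n)) (e : NodePair n) :
    graphEquivPairs n G e = true ↔ G.Adj e.1.1 e.1.2 := by
  classical
  simp [graphEquivPairs]

lemma prod_prod_Ioi_eq_prod_nodePair {n : ℕ} (F : Fin n → Fin n → ℝ) :
    ∏ i : Fin n, ∏ j ∈ Finset.Ioi i, F i j = ∏ e : NodePair n, F e.1.1 e.1.2 := by
  classical
  rw [← Finset.prod_subtype (Finset.univ.filter fun e : Fin n × Fin n => e.1 < e.2)
    (by simp) (fun e : Fin n × Fin n => F e.1 e.2), Finset.prod_filter, Fintype.prod_prod_type]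
  refine Finset.prod_congr rfl fun i _ => ?_
  rw [← Finset.prod_filter]
  refine Finset.prod_congr ?_ fun _ _ => rfl
  ext j; simp

lemma sum_pi_prod_eq_prod_sum {ι κ : Type*} [Fintype ι] [DecidableEq ι] [Fintype κ]
    (f : ι → κ → ℝ) : ∑ ω : ι → κ, ∏ i, f i (ω i) = ∏ i, ∑ c, f i c := by
  classical
  rw [Finset.prod_univ_sum, Fintype.piFinset_univ]

lemma sum_graph_prod_eq_prod_sum {n : ℕ} [Fintype (SimpleGraph (Fin n))]
    (f : NodePair n → Bool → ℝ) :
    ∑ G : SimpleGraph (Fin n), ∏ e, f e (graphEquivPairs n G e) = ∏ e, ∑ c, f e c := by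
  classical
  rw [← sum_pi_prod_eq_prod_sum f]
  exact (graphEquivPairs n).sum_comp (fun ω : NodePair n → Bool => ∏ e, f e (ω e))

/-- The pairs with exactly one node in `S`. -/
def cutPairs {n : ℕ} (S : Finset (Fin n)) : Finset (NodePair n) :=
  Finset.univ.filter fun e => ¬ (e.1.1 ∈ S ↔ e.1.2 ∈ S)

lemma mem_cutPairs {n : ℕ} {S : Finset (Fin n)} {e : NodePair n} :
    e ∈ cutPairs S ↔ ¬ (e.1.1 ∈ S ↔ e.1.2 ∈ S) := by simp [cutPairs]

/-- Each crossing pair has exactly one orientation leading from `S` to its complement. -/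
lemma card_cutPairs {n : ℕ} (S : Finset (Fin n)) :
    (cutPairs S).card = S.card * (n - S.card) := by
  classical
  have h : S.card * (n - S.card) = (S ×ˢ Sᶜ).card := by
    rw [Finset.card_product, Finset.card_compl, Fintype.card_fin]
  rw [h]
  refine Finset.card_bij (fun e _ => if e.1.1 ∈ S then (e.1.1, e.1.2) else (e.1.2, e.1.1)) ?_ ?_ ?_
  · rintro ⟨⟨i, j⟩, hij⟩ he
    rw [mem_cutPairs] at he
    dsimp only at he ⊢
    by_cases hi : i ∈ S <;> simp_all
  · rintro ⟨⟨i, j⟩, hij⟩ he ⟨⟨i', j'⟩, hij'⟩ he' heq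
    rw [mem_cutPairs] at he he'
    dsimp only at *
    have h1 : i < j := hij
    have h2 : i' < j' := hij'
    split_ifs at heq with hi hi' hi' <;> simp only [Prod.mk.injEq] at heq <;>
      obtain ⟨r1, r2⟩ := heq <;> subst r1 <;> subst r2
    · rfl
    · exact absurd h1 (not_lt_of_gt h2)
    · exact absurd h1 (not_lt_of_gt h2)
    · rfl
  · rintro ⟨u, v⟩ huv
    simp only [Finset.mem_product, Finset.mem_compl] at huv
    have hne : u ≠ v := fun h => huv.2 (h ▸ huv.1)
    rcases lt_or_gt_of_ne hne with h | h
    · exact ⟨⟨(u, v), h⟩, mem_cutPairs.2 (by simp [huv]), by simp [huv]⟩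
    · exact ⟨⟨(v, u), h⟩, mem_cutPairs.2 (by simp [huv]), by simp [huv]⟩

/-- The probability that a pair is an edge (`true`) or not (`false`), where `s` is the product of
the labels of its two nodes. -/
noncomputable def pairWeight (a b : ℝ) (n : ℕ) (s : ℤˣ) (c : Bool) : ℝ :=
  if c then (if s = 1 then sbmEdgeProb a n else sbmEdgeProb b n)
  else 1 - (if s = 1 then sbmEdgeProb a n else sbmEdgeProb b n)

lemma units_mul_eq_one_iff (s t : ℤˣ) : s * t = 1 ↔ s = t := by
  rcases Int.units_eq_one_or s with rfl | rfl <;> rcases Int.units_eq_one_or t with rfl | rfl <;>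
    decide

lemma units_ne_iff (s t : ℤˣ) : s ≠ t ↔ s = -t := by
  rcases Int.units_eq_one_or s with rfl | rfl <;> rcases Int.units_eq_one_or t with rfl | rfl <;>
    decide

lemma sbmGraphProb_eq_prod (a b : ℝ) {n : ℕ} (x : SBMLabels n) (G : SimpleGraph (Fin n)) :
    sbmGraphProb a b x G =
      ∏ e, pairWeight a b n (x e.1.1 * x e.1.2) (graphEquivPairs n G e) := by
  classical
  unfold sbmGraphProb
  rw [prod_prod_Ioi_eq_prod_nodePair]
  refine Finset.prod_congr rfl fun e _ => ?_
  simp only [pairWeight, graphEquivPairs_apply_eq_true, units_mul_eq_one_iff, sbmPairProb]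

lemma sbmEdgeProb_nonneg {c : ℝ} (hc : 0 ≤ c) (n : ℕ) : 0 ≤ sbmEdgeProb c n := by
  unfold sbmEdgeProb
  have := Real.log_natCast_nonneg n
  positivity

lemma sbmEdgeProb_le_one (c : ℝ) (n : ℕ) : sbmEdgeProb c n ≤ 1 := min_le_right _ _

lemma pairWeight_nonneg {a b : ℝ} (ha : 0 ≤ a) (hb : 0 ≤ b) (n : ℕ) (s : ℤˣ) (c : Bool) :
    0 ≤ pairWeight a b n s c := by
  have h1 := sbmEdgeProb_nonneg ha n
  have h2 := sbmEdgeProb_nonneg hb n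
  have h3 := sbmEdgeProb_le_one a n
  have h4 := sbmEdgeProb_le_one b n
  unfold pairWeight
  split_ifs <;> linarith

lemma sum_pairWeight (a b : ℝ) (n : ℕ) (s : ℤˣ) : ∑ c, pairWeight a b n s c = 1 := by
  simp [pairWeight]

/-! ### Affinities of the laws under two labelings -/

/-- The Bhattacharyya coefficient of the edge distributions within and across communities. -/
noncomputable def edgeAffinity (a b : ℝ) (n : ℕ) : ℝ :=
  ∑ c, √(pairWeight a b n 1 c) * √(pairWeight a b n (-1) c)

lemma edgeAffinity_nonneg (a b : ℝ) (n : ℕ) : 0 ≤ edgeAffinity a b n :=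
  Finset.sum_nonneg fun _ _ => by positivity

lemma sum_sqrt_pairWeight_mul_sqrt {a b : ℝ} (ha : 0 ≤ a) (hb : 0 ≤ b) (n : ℕ) (s t : ℤˣ) :
    ∑ c, √(pairWeight a b n s c) * √(pairWeight a b n t c) =
      if s = t then 1 else edgeAffinity a b n := by
  split_ifs with h
  · subst h
    rw [← sum_pairWeight a b n s]
    exact Finset.sum_congr rfl fun c _ => Real.mul_self_sqrt (pairWeight_nonneg ha hb n s c)
  · rcases Int.units_eq_one_or s with rfl | rfl <;> rcases Int.units_eq_one_or t with rfl | rfl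
    · exact absurd rfl h
    · rfl
    · exact Finset.sum_congr rfl fun c _ => mul_comm _ _
    · exact absurd rfl h

/-- The nodes at which two labelings differ. -/
def diffNodes {n : ℕ} (x z : SBMLabels n) : Finset (Fin n) := Finset.univ.filter fun i => x i ≠ z i

lemma mem_diffNodes {n : ℕ} {x z : SBMLabels n} {i : Fin n} : i ∈ diffNodes x z ↔ x i ≠ z i := by
  simp [diffNodes]

lemma sqrt_prod' {ι : Type*} (s : Finset ι) (f : ι → ℝ) (hf : ∀ i, 0 ≤ f i) :
    √(∏ i ∈ s, f i) = ∏ i ∈ s, √(f i) := by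
  classical
  induction s using Finset.induction_on with
  | empty => simp
  | insert i s hi ih => rw [Finset.prod_insert hi, Finset.prod_insert hi, Real.sqrt_mul (hf i), ih]

lemma mul_eq_mul_iff_diffNodes {n : ℕ} (x z : SBMLabels n) (i j : Fin n) :
    x i * x j = z i * z j ↔ (i ∈ diffNodes x z ↔ j ∈ diffNodes x z) := by
  simp only [mem_diffNodes]
  generalize x i = p; generalize x j = q; generalize z i = r; generalize z j = s
  rcases Int.units_eq_one_or p with rfl | rfl <;> rcases Int.units_eq_one_or q with rfl | rfl <;>
    rcases Int.units_eq_one_or r with rfl | rfl <;> rcases Int.units_eq_one_or s with rfl | rfl <;>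
    decide

/-- Affinities multiply over independent pairs. A pair has different laws under `x` and `z` only if
exactly one of its ends is relabeled; every other pair contributes `1`. -/
lemma sum_sqrt_graphProb_mul_sqrt {a b : ℝ} (ha : 0 ≤ a) (hb : 0 ≤ b) {n : ℕ}
    [Fintype (SimpleGraph (Fin n))] (x z : SBMLabels n) :
    ∑ G, √(sbmGraphProb a b x G) * √(sbmGraphProb a b z G) =
      edgeAffinity a b n ^ ((diffNodes x z).card * (n - (diffNodes x z).card)) := by
  classical
  simp only [sbmGraphProb_eq_prod, sqrt_prod' _ _ fun e => pairWeight_nonneg ha hb n _ _,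
    ← Finset.prod_mul_distrib]
  rw [sum_graph_prod_eq_prod_sum (fun e c => √(pairWeight a b n (x e.1.1 * x e.1.2) c) *
    √(pairWeight a b n (z e.1.1 * z e.1.2) c))]
  simp only [sum_sqrt_pairWeight_mul_sqrt ha hb, mul_eq_mul_iff_diffNodes]
  rw [← card_cutPairs, Finset.prod_ite]
  simp [cutPairs]

lemma sbmGraphProb_nonneg {a b : ℝ} (ha : 0 ≤ a) (hb : 0 ≤ b) {n : ℕ} (x : SBMLabels n)
    (G : SimpleGraph (Fin n)) : 0 ≤ sbmGraphProb a b x G := by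
  rw [sbmGraphProb_eq_prod]
  exact Finset.prod_nonneg fun e _ => pairWeight_nonneg ha hb _ _ _

lemma sum_sbmGraphProb (a b : ℝ) {n : ℕ} [Fintype (SimpleGraph (Fin n))] (x : SBMLabels n) :
    ∑ G, sbmGraphProb a b x G = 1 := by
  simp only [sbmGraphProb_eq_prod]
  rw [sum_graph_prod_eq_prod_sum (fun e c => pairWeight a b n (x e.1.1 * x e.1.2) c)]
  simp only [sum_pairWeight, Finset.prod_const_one]

lemma sum_sideInfo_prod {n K M : ℕ} (f : Fin n → Fin M → ℝ) :
    ∑ y : SBMSideInfo n K M, ∏ i, ∏ k, f i (y i k) = ∏ i, (∑ m, f i m) ^ K := by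
  classical
  rw [sum_pi_prod_eq_prod_sum (fun (i : Fin n) (u : Fin K → Fin M) => ∏ k, f i (u k))]
  refine Finset.prod_congr rfl fun i _ => ?_
  rw [sum_pi_prod_eq_prod_sum (fun (_ : Fin K) m => f i m)]
  simp

/-- The Bhattacharyya coefficient of the feature distributions of the two communities. -/
noncomputable def featureAffinity {M : ℕ} (α : ℤˣ → Fin M → ℝ) : ℝ :=
  ∑ m, √(α 1 m) * √(α (-1) m)

lemma sbmSideProb_nonneg {n K M : ℕ} {α : ℤˣ → Fin M → ℝ} (hα : ∀ s m, 0 < α s m)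
    (x : SBMLabels n) (y : SBMSideInfo n K M) : 0 ≤ sbmSideProb α x y :=
  Finset.prod_nonneg fun _ _ => Finset.prod_nonneg fun _ _ => (hα _ _).le

lemma sum_sbmSideProb {n K M : ℕ} {α : ℤˣ → Fin M → ℝ} (hs : ∀ s, ∑ m, α s m = 1)
    (x : SBMLabels n) : ∑ y : SBMSideInfo n K M, sbmSideProb α x y = 1 := by
  unfold sbmSideProb
  rw [sum_sideInfo_prod (fun i m => α (x i) m)]
  simp [hs]

lemma sum_sqrt_sideProb_mul_sqrt {n K M : ℕ} {α : ℤˣ → Fin M → ℝ} (hα : ∀ s m, 0 < α s m)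
    (hs : ∀ s, ∑ m, α s m = 1) (x z : SBMLabels n) :
    ∑ y : SBMSideInfo n K M, √(sbmSideProb α x y) * √(sbmSideProb α z y) =
      featureAffinity α ^ (K * (diffNodes x z).card) := by
  classical
  have key : ∀ s t : ℤˣ, ∑ m, √(α s m) * √(α t m) = if s ≠ t then featureAffinity α else 1 := by
    intro s t
    rcases eq_or_ne s t with rfl | h
    · simp only [ne_eq, not_true_eq_false, if_false]
      rw [← hs s]
      exact Finset.sum_congr rfl fun m _ => Real.mul_self_sqrt (hα s m).le
    · rw [if_pos h]
      rcases Int.units_eq_one_or s with rfl | rfl <;> rcases Int.units_eq_one_or t with rfl | rfl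
      · exact absurd rfl h
      · rfl
      · exact Finset.sum_congr rfl fun c _ => mul_comm _ _
      · exact absurd rfl h
  have h1 : ∀ (x : SBMLabels n) (y : SBMSideInfo n K M),
      √(sbmSideProb α x y) = ∏ i, ∏ k, √(α (x i) (y i k)) := by
    intro x y
    unfold sbmSideProb
    rw [sqrt_prod' _ _ fun i => Finset.prod_nonneg fun _ _ => (hα _ _).le]
    exact Finset.prod_congr rfl fun i _ => sqrt_prod' _ _ fun k => (hα _ _).le
  simp only [h1, ← Finset.prod_mul_distrib]
  rw [sum_sideInfo_prod (fun i m => √(α (x i) m) * √(α (z i) m))]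
  simp only [key]
  rw [Finset.prod_pow, Finset.prod_ite, pow_mul']
  simp [diffNodes]

/-! ### The joint law and the union bound -/

lemma sbmJointProb_nonneg {a b : ℝ} (ha : 0 ≤ a) (hb : 0 ≤ b) {n K M : ℕ} {α : ℤˣ → Fin M → ℝ}
    (hα : ∀ s m, 0 < α s m) (x : SBMLabels n) (G : SimpleGraph (Fin n))
    (y : SBMSideInfo n K M) : 0 ≤ sbmJointProb a b α x G y :=
  mul_nonneg (mul_nonneg (by positivity) (sbmGraphProb_nonneg ha hb x G))
    (sbmSideProb_nonneg hα x y)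

lemma sum_sbmJointProb (a b : ℝ) {n K M : ℕ} [Fintype (SimpleGraph (Fin n))]
    {α : ℤˣ → Fin M → ℝ} (hs : ∀ s, ∑ m, α s m = 1) :
    ∑ x : SBMLabels n, ∑ G : SimpleGraph (Fin n), ∑ y : SBMSideInfo n K M,
      sbmJointProb a b α x G y = 1 := by
  unfold sbmJointProb
  simp only [← Finset.mul_sum, sum_sbmSideProb hs, mul_one, sum_sbmGraphProb]
  simp [Finset.card_univ, SBMLabels]

lemma sbmProb_add_not (a b : ℝ) (n K : ℕ) {M : ℕ} {α : ℤˣ → Fin M → ℝ}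
    (hs : ∀ s, ∑ m, α s m = 1)
    (S : SBMLabels n → SimpleGraph (Fin n) → SBMSideInfo n K M → Prop) :
    sbmProb a b n K α S + sbmProb a b n K α (fun x G y => ¬ S x G y) = 1 := by
  classical
  unfold sbmProb
  rw [← sum_sbmJointProb a b (n := n) (K := K) hs]
  simp only [← Finset.sum_add_distrib]
  refine Finset.sum_congr rfl fun x _ => Finset.sum_congr (by ext; simp) fun G _ =>
    Finset.sum_congr rfl fun y _ => ?_
  by_cases h : S x G y <;> simp [h]

lemma sbmProb_nonneg {a b : ℝ} (ha : 0 ≤ a) (hb : 0 ≤ b) (n K : ℕ) {M : ℕ} {α : ℤˣ → Fin M → ℝ}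
    (hα : ∀ s m, 0 < α s m)
    (S : SBMLabels n → SimpleGraph (Fin n) → SBMSideInfo n K M → Prop) :
    0 ≤ sbmProb a b n K α S := by
  classical
  unfold sbmProb
  refine Finset.sum_nonneg fun x _ => Finset.sum_nonneg fun G _ => Finset.sum_nonneg fun y _ => ?_
  split_ifs
  · exact sbmJointProb_nonneg ha hb hα x G y
  · exact le_rfl

lemma diffNodes_bijective {n : ℕ} (x : SBMLabels n) :
    Function.Bijective (diffNodes x) := by
  classical
  constructor
  · intro z z' h
    ext1 i
    have h1 : i ∈ diffNodes x z ↔ i ∈ diffNodes x z' := by rw [h]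
    simp only [mem_diffNodes] at h1
    by_cases h2 : x i = z i
    · have h3 : x i = z' i := by by_contra h3; exact h1.2 h3 h2
      rw [← h2, h3]
    · have h3 := (units_ne_iff _ _).1 (h1.1 h2)
      have h4 := (units_ne_iff _ _).1 h2
      exact neg_injective (h4.symm.trans h3)
  · intro S
    refine ⟨fun i => if i ∈ S then -x i else x i, ?_⟩
    ext i
    rw [mem_diffNodes]
    by_cases h : i ∈ S
    · simp [h]
    · simp [h]

lemma sum_card_diffNodes {n : ℕ} (x : SBMLabels n) (g : ℕ → ℝ) :
    ∑ z, g (diffNodes x z).card = ∑ k ∈ Finset.range (n + 1), (n.choose k : ℝ) * g k := by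
  classical
  rw [(diffNodes_bijective x).sum_comp (fun S => g S.card), ← Finset.powerset_univ,
    Finset.sum_powerset_apply_card]
  simp

lemma card_diffNodes_le {n : ℕ} (x z : SBMLabels n) : (diffNodes x z).card ≤ n := by
  simpa using Finset.card_le_univ (diffNodes x z)

lemma card_diffNodes_pos {n : ℕ} {x z : SBMLabels n} (h : z ≠ x) : 0 < (diffNodes x z).card := by
  obtain ⟨i, hi⟩ := Function.ne_iff.1 h
  exact Finset.card_pos.2 ⟨i, mem_diffNodes.2 hi.symm⟩

lemma card_diffNodes_lt {n : ℕ} {x z : SBMLabels n} (h : z ≠ -x) : (diffNodes x z).card < n := by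
  obtain ⟨i, hi⟩ := Function.ne_iff.1 h
  have : (diffNodes x z).card < (Finset.univ : Finset (Fin n)).card := by
    refine Finset.card_lt_card (Finset.ssubset_univ_iff.2 fun h' => hi ?_)
    have h1 : i ∈ diffNodes x z := h' ▸ Finset.mem_univ i
    rw [mem_diffNodes, units_ne_iff] at h1
    simp [h1]
  simpa using this

/-- A maximum a posteriori estimator. -/
lemma exists_map_estimator (a b : ℝ) (n K : ℕ) {M : ℕ} (α : ℤˣ → Fin M → ℝ) :
    ∃ xhat : SBMEstimator n K M, ∀ x G y,
      sbmJointProb a b α x G y ≤ sbmJointProb a b α (xhat G y) G y := by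
  choose f hf using fun (G : SimpleGraph (Fin n)) (y : SBMSideInfo n K M) =>
    Finite.exists_max (fun x => sbmJointProb a b α x G y)
  exact ⟨f, fun x G y => hf G y x⟩

lemma sum_sqrt_jointProb_mul_sqrt {a b : ℝ} (ha : 0 ≤ a) (hb : 0 ≤ b) {n K M : ℕ}
    [Fintype (SimpleGraph (Fin n))] {α : ℤˣ → Fin M → ℝ}
    (hα : ∀ s m, 0 < α s m) (hs : ∀ s, ∑ m, α s m = 1) (x z : SBMLabels n) :
    ∑ G : SimpleGraph (Fin n), ∑ y : SBMSideInfo n K M,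
      √(sbmJointProb a b α x G y) * √(sbmJointProb a b α z G y) =
      (1 / 2) ^ n * (edgeAffinity a b n ^ ((diffNodes x z).card * (n - (diffNodes x z).card)) *
        featureAffinity α ^ (K * (diffNodes x z).card)) := by
  rw [← sum_sqrt_graphProb_mul_sqrt ha hb, ← sum_sqrt_sideProb_mul_sqrt hα hs,
    Finset.sum_mul_sum, Finset.mul_sum]
  refine Finset.sum_congr rfl fun G _ => ?_
  rw [Finset.mul_sum]
  refine Finset.sum_congr rfl fun y _ => ?_
  unfold sbmJointProb
  have h0 : (0 : ℝ) ≤ (1 / 2) ^ n := by positivity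
  have h1 := fun x => sbmGraphProb_nonneg ha hb x G
  rw [Real.sqrt_mul (mul_nonneg h0 (h1 x)), Real.sqrt_mul (mul_nonneg h0 (h1 z)),
    Real.sqrt_mul h0, Real.sqrt_mul h0]
  have h2 := Real.mul_self_sqrt h0
  linear_combination (√(sbmGraphProb a b x G) * √(sbmGraphProb a b z G) *
    (√(sbmSideProb α x y) * √(sbmSideProb α z y))) * h2

/-- The union bound over wrong labelings for a maximum a posteriori estimator. -/
lemma sbmProb_map_estimator_le {a b : ℝ} (ha : 0 ≤ a) (hb : 0 ≤ b) {n K M : ℕ}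
    {α : ℤˣ → Fin M → ℝ} (hα : ∀ s m, 0 < α s m) (hs : ∀ s, ∑ m, α s m = 1)
    {xhat : SBMEstimator n K M}
    (hx : ∀ x G y, sbmJointProb a b α x G y ≤ sbmJointProb a b α (xhat G y) G y)
    (R : SBMLabels n → SBMLabels n → Prop) (g : ℕ → ℝ) (hg0 : ∀ k ≤ n, 0 ≤ g k)
    (hg : ∀ x z, R x z → edgeAffinity a b n ^ ((diffNodes x z).card * (n - (diffNodes x z).card)) *
        featureAffinity α ^ (K * (diffNodes x z).card) ≤ g (diffNodes x z).card) :
    sbmProb a b n K α (fun x G y => R x (xhat G y)) ≤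
      ∑ k ∈ Finset.range (n + 1), (n.choose k : ℝ) * g k := by
  classical
  have step : ∀ x : SBMLabels n, ∑ G : SimpleGraph (Fin n), ∑ y : SBMSideInfo n K M,
      (if R x (xhat G y) then sbmJointProb a b α x G y else 0) ≤
      (1 / 2) ^ n * ∑ k ∈ Finset.range (n + 1), (n.choose k : ℝ) * g k := by
    intro x
    calc _ ≤ ∑ G : SimpleGraph (Fin n), ∑ y : SBMSideInfo n K M, ∑ z : SBMLabels n,
          if R x z then √(sbmJointProb a b α x G y) * √(sbmJointProb a b α z G y) else 0 := by
          refine Finset.sum_le_sum fun G _ => Finset.sum_le_sum fun y _ => ?_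
          have hnn : ∀ z ∈ (Finset.univ : Finset (SBMLabels n)), (0 : ℝ) ≤
              if R x z then √(sbmJointProb a b α x G y) * √(sbmJointProb a b α z G y) else 0 := by
            intro z _; split_ifs <;> positivity
          refine le_trans ?_ (Finset.single_le_sum hnn (Finset.mem_univ (xhat G y)))
          split_ifs
          · have h0 := sbmJointProb_nonneg ha hb hα x G y
            -- Maximality of the posterior at `xhat G y` allows one of the two roots to be replaced
            -- by its value there.
            calc _ = √(sbmJointProb a b α x G y) * √(sbmJointProb a b α x G y) :=
                  (Real.mul_self_sqrt h0).symm
              _ ≤ _ := mul_le_mul_of_nonneg_left (Real.sqrt_le_sqrt (hx x G y)) (by positivity)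
          · exact le_rfl
      _ = ∑ z : SBMLabels n, if R x z then ∑ G : SimpleGraph (Fin n), ∑ y : SBMSideInfo n K M,
            √(sbmJointProb a b α x G y) * √(sbmJointProb a b α z G y) else 0 := by
          rw [Finset.sum_congr rfl fun G _ => Finset.sum_comm, Finset.sum_comm]
          refine Finset.sum_congr rfl fun z _ => ?_
          split_ifs <;> simp
      _ ≤ ∑ z : SBMLabels n, (1 / 2) ^ n * g (diffNodes x z).card := by
          refine Finset.sum_le_sum fun z _ => ?_
          split_ifs with h
          · rw [sum_sqrt_jointProb_mul_sqrt ha hb hα hs]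
            exact mul_le_mul_of_nonneg_left (hg x z h) (by positivity)
          · exact mul_nonneg (by positivity) (hg0 _ (card_diffNodes_le x z))
      _ = _ := by rw [← Finset.mul_sum, sum_card_diffNodes]
  unfold sbmProb
  refine (Finset.sum_le_sum fun x _ => (?_ : _ ≤ (1 / 2 : ℝ) ^ n *
    ∑ k ∈ Finset.range (n + 1), (n.choose k : ℝ) * g k)).trans (le_of_eq ?_)
  · convert step x
  · rw [Finset.sum_const, nsmul_eq_mul, ← mul_assoc]
    simp [Finset.card_univ, SBMLabels]

/-! ### Upper bound for the affinity and the sum over cuts -/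

lemma sbmEdgeProb_eventually_eq (c : ℝ) :
    ∀ᶠ n : ℕ in atTop, sbmEdgeProb c n = c * Real.log n / n := by
  have h : Tendsto (fun n : ℕ => c * (Real.log n / n)) atTop (𝓝 (c * 0)) :=
    (((Real.isLittleO_log_id_atTop.comp_tendsto tendsto_natCast_atTop_atTop).tendsto_div_nhds_zero)
      ).const_mul c
  rw [mul_zero] at h
  filter_upwards [h.eventually (gt_mem_nhds one_pos)] with n hn
  rw [sbmEdgeProb, min_eq_left]
  rw [mul_div_assoc]; exact hn.le

lemma edgeAffinity_eq_one_sub {a b : ℝ} (ha : 0 ≤ a) (hb : 0 ≤ b) (n : ℕ) :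
    edgeAffinity a b n = 1 - ((√(sbmEdgeProb a n) - √(sbmEdgeProb b n)) ^ 2 +
      (√(1 - sbmEdgeProb a n) - √(1 - sbmEdgeProb b n)) ^ 2) / 2 := by
  have h1 := Real.sq_sqrt (sbmEdgeProb_nonneg ha n)
  have h2 := Real.sq_sqrt (sbmEdgeProb_nonneg hb n)
  have h3 := Real.sq_sqrt (sub_nonneg.2 (sbmEdgeProb_le_one a n))
  have h4 := Real.sq_sqrt (sub_nonneg.2 (sbmEdgeProb_le_one b n))
  have h5 : edgeAffinity a b n = √(sbmEdgeProb a n) * √(sbmEdgeProb b n) +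
      √(1 - sbmEdgeProb a n) * √(1 - sbmEdgeProb b n) := by
    simp [edgeAffinity, pairWeight, show ((-1 : ℤˣ) = 1) = False by simp]
  rw [h5]
  nlinarith

lemma sq_sqrt_sub_sqrt_edgeProb {a b : ℝ} (ha : 0 ≤ a) (hb : 0 ≤ b) {n : ℕ}
    (h1 : sbmEdgeProb a n = a * Real.log n / n) (h2 : sbmEdgeProb b n = b * Real.log n / n) :
    (√(sbmEdgeProb a n) - √(sbmEdgeProb b n)) ^ 2 = (√a - √b) ^ 2 * Real.log n / n := by
  have hl : 0 ≤ Real.log n / n := div_nonneg (Real.log_natCast_nonneg n) (by positivity)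
  rw [h1, h2, mul_div_assoc, mul_div_assoc, Real.sqrt_mul ha, Real.sqrt_mul hb, ← sub_mul, mul_pow,
    Real.sq_sqrt hl, mul_div_assoc]

/-- The squared Hellinger distance is bounded below by its edge part alone; the non-edge part is
nonnegative and is dropped. -/
lemma edgeAffinity_le_exp {a b : ℝ} (ha : 0 ≤ a) (hb : 0 ≤ b) :
    ∀ᶠ n : ℕ in atTop,
      edgeAffinity a b n ≤ Real.exp (-((√a - √b) ^ 2 / 2 * (Real.log n / n))) := by
  filter_upwards [sbmEdgeProb_eventually_eq a, sbmEdgeProb_eventually_eq b] with n h1 h2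
  have h3 := sq_sqrt_sub_sqrt_edgeProb ha hb h1 h2
  have h4 := Real.add_one_le_exp (-((√a - √b) ^ 2 / 2 * (Real.log n / n)))
  have h5 := sq_nonneg (√(1 - sbmEdgeProb a n) - √(1 - sbmEdgeProb b n))
  rw [edgeAffinity_eq_one_sub ha hb, h3]
  have h6 : (√a - √b) ^ 2 / 2 * (Real.log n / n) = (√a - √b) ^ 2 * Real.log n / n / 2 := by ring
  linarith

/-- The expected number of cuts weighted by `n ^ (-c / n)` per crossing pair vanishes. -/
lemma tendsto_sum_choose_mul_exp {c : ℝ} (hc : 1 < c) :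
    Tendsto (fun n : ℕ => ∑ k ∈ Finset.Ioo 0 n, (n.choose k : ℝ) *
      Real.exp (-(c * (Real.log n / n))) ^ (k * (n - k))) atTop (𝓝 0) := by
  -- `δ` is chosen so that `c * (1 - δ) = 1 + γ` still exceeds `1`. For `k ≤ δ n` the bound `n ^ k`
  -- on the binomial then leaves `n ^ (-γ k)`, and likewise for `n - k ≤ δ n`; in between, each term
  -- is at most `n.choose k * n ^ (-β n)`, which beats the total `2 ^ n` of the binomials.
  set γ : ℝ := (c - 1) / 2 with hγ
  set δ : ℝ := (c - 1) / (2 * c) with hδ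
  have hδ0 : 0 < δ := div_pos (by linarith) (by linarith)
  have hδ1 : δ < 1 := by rw [hδ, div_lt_one (by linarith)]; linarith
  have hcδ : c * (1 - δ) = 1 + γ := by rw [hδ, hγ]; field_simp; ring
  set β : ℝ := c * (δ * (1 - δ)) with hβ
  have hβ0 : 0 < β := mul_pos (by linarith) (mul_pos hδ0 (by linarith))
  have hlog : Tendsto (fun n : ℕ => Real.log n) atTop atTop :=
    Real.tendsto_log_atTop.comp tendsto_natCast_atTop_atTop
  have hexp : ∀ t : ℝ, 0 < t → Tendsto (fun n : ℕ => Real.exp (-(t * Real.log n))) atTop (𝓝 0) :=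
    fun t ht => Real.tendsto_exp_neg_atTop_nhds_zero.comp (hlog.const_mul_atTop ht)
  have hu := hexp γ (by rw [hγ]; linarith)
  have hv := hexp β hβ0
  have hlim : Tendsto (fun n : ℕ => 4 * Real.exp (-(γ * Real.log n)) +
      2 * Real.exp (-(β * Real.log n))) atTop (𝓝 0) := by
    simpa using (hu.const_mul 4).add (hv.const_mul 2)
  refine tendsto_of_tendsto_of_tendsto_of_le_of_le' tendsto_const_nhds hlim
    (Eventually.of_forall fun n => Finset.sum_nonneg fun k _ => by positivity) ?_
  filter_upwards [hu.eventually (gt_mem_nhds (show (0 : ℝ) < 1 / 2 by norm_num)),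
    hv.eventually (gt_mem_nhds (show (0 : ℝ) < 1 / 2 by norm_num)), eventually_ge_atTop 1]
    with n hun hvn hn
  set L := Real.log n with hL
  have hL0 : 0 ≤ L := Real.log_natCast_nonneg n
  set u := Real.exp (-(γ * L)) with hu'
  set v := Real.exp (-(β * L)) with hv'
  have hn0 : (0 : ℝ) < n := by exact_mod_cast hn
  have hnL : (n : ℝ) = Real.exp L := (Real.exp_log hn0).symm
  have small : ∀ k m : ℕ, k + m = n → (k : ℝ) ≤ δ * n →
      (n.choose k : ℝ) * Real.exp (-(c * (L / n))) ^ (k * m) ≤ u ^ k := by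
    intro k m hkm hk
    have h1 : (n.choose k : ℝ) ≤ Real.exp (k * L) := by
      rw [Real.exp_nat_mul, ← hnL]
      exact_mod_cast Nat.choose_le_pow n k
    have hm : (1 - δ) * n ≤ m := by
      have : (k : ℝ) + m = n := by exact_mod_cast hkm
      linarith
    calc _ ≤ Real.exp (k * L) * Real.exp (-(c * (L / n))) ^ (k * m) := by gcongr
      _ = Real.exp (k * L + (k * m : ℕ) * -(c * (L / n))) := by
        rw [Real.exp_add, Real.exp_nat_mul, Real.exp_nat_mul]
      _ ≤ Real.exp (k * -(γ * L)) := by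
        apply Real.exp_le_exp.2
        have h2 : (k * L * c) * ((1 - δ) * n / n) ≤ (k * L * c) * (m / n) := by gcongr
        rw [mul_div_cancel_right₀ _ hn0.ne'] at h2
        have h3 : (k * L * c) * (1 - δ) = k * L * (1 + γ) := by rw [← hcδ]; ring
        push_cast
        have h4 : (k * m : ℝ) * -(c * (L / n)) = -((k * L * c) * (m / n)) := by ring
        rw [h4]
        linarith
      _ = u ^ k := Real.exp_nat_mul _ _
  have term : ∀ k ∈ Finset.Ioo 0 n, (n.choose k : ℝ) *
      Real.exp (-(c * (L / n))) ^ (k * (n - k)) ≤ u ^ k + u ^ (n - k) + n.choose k * v ^ n := by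
    intro k hk
    rw [Finset.mem_Ioo] at hk
    have hu0 : 0 < u := Real.exp_pos _
    have hv0 : 0 < v := Real.exp_pos _
    have p1 : 0 ≤ u ^ k := by positivity
    have p2 : 0 ≤ u ^ (n - k) := by positivity
    have p3 : 0 ≤ n.choose k * v ^ n := by positivity
    have hkn : k + (n - k) = n := by omega
    by_cases h1 : (k : ℝ) ≤ δ * n
    · linarith [small k (n - k) hkn h1]
    by_cases h2 : ((n - k : ℕ) : ℝ) ≤ δ * n
    · have := small (n - k) k (by omega) h2
      rw [Nat.choose_symm hk.2.le, mul_comm (n - k)] at this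
      linarith
    have h3 : Real.exp (-(c * (L / n))) ^ (k * (n - k)) ≤ v ^ n := by
      rw [← Real.exp_nat_mul, ← Real.exp_nat_mul]
      apply Real.exp_le_exp.2
      push Not at h1 h2
      generalize n - k = m at *
      have hs : (k : ℝ) + m = n := by exact_mod_cast hkn
      -- Expand `(k - δ n) * (m - δ n) > 0` using `k + m = n`.
      have h4 : δ * (1 - δ) * n * n ≤ (k * m : ℕ) := by
        push_cast
        nlinarith [mul_pos (sub_pos.2 h1) (sub_pos.2 h2)]
      have h5 : (c * L / n) * (δ * (1 - δ) * n * n) ≤ (c * L / n) * (k * m : ℕ) := by gcongr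
      have h6 : (c * L / n) * (δ * (1 - δ) * n * n) = n * (β * L) := by
        rw [hβ]; field_simp
      have h7 : (k * m : ℕ) * -(c * (L / n)) = -((c * L / n) * (k * m : ℕ)) := by ring
      rw [h7]
      linarith
    have := mul_le_mul_of_nonneg_left h3 (Nat.cast_nonneg (α := ℝ) (n.choose k))
    linarith
  have hu0 : 0 < u := Real.exp_pos _
  have hv0 : 0 < v := Real.exp_pos _
  have geo : ∑ k ∈ Finset.Ioo 0 n, u ^ k ≤ 2 * u := by
    have h := geom_sum_Ico_le_of_lt_one (m := 1) (n := n) hu0.le (by linarith)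
    have h' : u ^ 1 / (1 - u) ≤ 2 * u := by
      rw [div_le_iff₀ (by linarith)]; nlinarith
    exact h.trans h'
  have geo' : ∑ k ∈ Finset.Ioo 0 n, u ^ (n - k) = ∑ k ∈ Finset.Ioo 0 n, u ^ k := by
    refine Finset.sum_nbij' (fun k => n - k) (fun k => n - k) ?_ ?_ ?_ ?_ ?_ <;>
      simp only [Finset.mem_Ioo] <;> intros <;> first | omega | trivial
  have mid : ∑ k ∈ Finset.Ioo 0 n, (n.choose k : ℝ) * v ^ n ≤ 2 * v := by
    rw [← Finset.sum_mul]
    have h1 : ∑ k ∈ Finset.Ioo 0 n, (n.choose k : ℝ) ≤ 2 ^ n := by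
      have h2 : ∑ k ∈ Finset.range (n + 1), (n.choose k : ℝ) = 2 ^ n := by
        exact_mod_cast Nat.sum_range_choose n
      rw [← h2]
      refine Finset.sum_le_sum_of_subset_of_nonneg (fun k hk => ?_) fun _ _ _ => by positivity
      rw [Finset.mem_Ioo] at hk
      rw [Finset.mem_range]; omega
    calc _ ≤ 2 ^ n * v ^ n := by gcongr
      _ = (2 * v) ^ n := (mul_pow _ _ _).symm
      _ ≤ (2 * v) ^ 1 := pow_le_pow_of_le_one (by positivity) (by linarith) hn
      _ = 2 * v := pow_one _
  calc _ ≤ _ := Finset.sum_le_sum term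
    _ = ∑ k ∈ Finset.Ioo 0 n, u ^ k + ∑ k ∈ Finset.Ioo 0 n, u ^ (n - k) +
        ∑ k ∈ Finset.Ioo 0 n, (n.choose k : ℝ) * v ^ n := by
      rw [Finset.sum_add_distrib, Finset.sum_add_distrib]
    _ ≤ _ := by rw [geo']; linarith

/-! ### Exact recovery above the threshold -/

lemma featureAffinity_nonneg {M : ℕ} (α : ℤˣ → Fin M → ℝ) : 0 ≤ featureAffinity α :=
  Finset.sum_nonneg fun _ _ => by positivity

lemma featureAffinity_eq_one_sub {M : ℕ} {α : ℤˣ → Fin M → ℝ} (hα : ∀ s m, 0 < α s m)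
    (hs : ∀ s, ∑ m, α s m = 1) :
    featureAffinity α = 1 - (∑ m, (√(α 1 m) - √(α (-1) m)) ^ 2) / 2 := by
  have h : ∑ m, (√(α 1 m) - √(α (-1) m)) ^ 2 = ∑ m, α 1 m + ∑ m, α (-1) m -
      2 * featureAffinity α := by
    rw [featureAffinity, Finset.mul_sum, ← Finset.sum_add_distrib, ← Finset.sum_sub_distrib]
    refine Finset.sum_congr rfl fun m _ => ?_
    rw [sub_sq, Real.sq_sqrt (hα 1 m).le, Real.sq_sqrt (hα (-1) m).le]
    ring
  rw [h, hs, hs]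
  ring

lemma featureAffinity_le_one {M : ℕ} {α : ℤˣ → Fin M → ℝ} (hα : ∀ s m, 0 < α s m)
    (hs : ∀ s, ∑ m, α s m = 1) : featureAffinity α ≤ 1 := by
  have h : 0 ≤ ∑ m, (√(α 1 m) - √(α (-1) m)) ^ 2 := Finset.sum_nonneg fun m _ => sq_nonneg _
  rw [featureAffinity_eq_one_sub hα hs]
  linarith

lemma featureAffinity_lt_one {M : ℕ} {α : ℤˣ → Fin M → ℝ} (hα : ∀ s m, 0 < α s m)
    (hs : ∀ s, ∑ m, α s m = 1) (hne : α 1 ≠ α (-1)) : featureAffinity α < 1 := by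
  obtain ⟨m, hm⟩ := Function.ne_iff.1 hne
  have hm' : √(α 1 m) - √(α (-1) m) ≠ 0 := fun h =>
    hm ((Real.sqrt_inj (hα 1 m).le (hα (-1) m).le).1 (sub_eq_zero.1 h))
  have h : 0 < ∑ m, (√(α 1 m) - √(α (-1) m)) ^ 2 :=
    Finset.sum_pos' (fun m _ => sq_nonneg _) ⟨m, Finset.mem_univ m, by positivity⟩
  rw [featureAffinity_eq_one_sub hα hs]
  linarith

/-- Isolates the truth (`k = 0`) and its global negation (`k = n`), each being a single labeling. -/
lemma sum_range_succ_choose_ite (n : ℕ) (hn : 0 < n) (g : ℕ → ℝ) (t : ℝ) :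
    ∑ k ∈ Finset.range (n + 1), (n.choose k : ℝ) *
      (if k = 0 then 0 else if k = n then t else g k) =
      ∑ k ∈ Finset.Ioo 0 n, (n.choose k : ℝ) * g k + t := by
  obtain ⟨n, rfl⟩ : ∃ m, n = m + 1 := ⟨n - 1, by omega⟩
  rw [Finset.sum_range_succ, Finset.sum_range_succ']
  have h1 : Finset.Ioo 0 (n + 1) = Finset.Ico 1 (n + 1) := rfl
  rw [h1, Finset.sum_Ico_eq_sum_range]
  simp only [add_tsub_cancel_right, add_comm 1]
  simp
  refine Finset.sum_congr rfl fun k hk => ?_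
  rw [Finset.mem_range] at hk
  rw [if_neg (by omega)]

lemma tendsto_sbmProb_of_bound {a b : ℝ} (ha : 0 ≤ a) (hb : 0 ≤ b) {K : ℕ → ℕ} {M : ℕ}
    {α : ℤˣ → Fin M → ℝ} (hα : ∀ s m, 0 < α s m) (hs : ∀ s, ∑ m, α s m = 1)
    {S : ∀ n, SBMLabels n → SimpleGraph (Fin n) → SBMSideInfo n (K n) M → Prop} {u : ℕ → ℝ}
    (hu : Tendsto u atTop (𝓝 0))
    (h : ∀ᶠ n in atTop, sbmProb a b n (K n) α (fun x G y => ¬ S n x G y) ≤ u n) :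
    Tendsto (fun n => sbmProb a b n (K n) α (S n)) atTop (𝓝 1) := by
  have h1 : Tendsto (fun n => 1 - u n) atTop (𝓝 1) := by simpa using hu.const_sub 1
  refine tendsto_of_tendsto_of_tendsto_of_le_of_le' h1 tendsto_const_nhds ?_ ?_
  · filter_upwards [h] with n hn
    linarith [sbmProb_add_not a b n (K n) hs (S n)]
  · filter_upwards with n
    linarith [sbmProb_add_not a b n (K n) hs (S n),
      sbmProb_nonneg ha hb n (K n) hα (fun x G y => ¬ S n x G y)]

lemma affinity_pow_le {a b : ℝ} {n K : ℕ} {M : ℕ} {α : ℤˣ → Fin M → ℝ}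
    (hα : ∀ s m, 0 < α s m) (hs : ∀ s, ∑ m, α s m = 1) {r : ℝ} (hr : edgeAffinity a b n ≤ r)
    (k l : ℕ) : edgeAffinity a b n ^ k * featureAffinity α ^ (K * l) ≤ r ^ k :=
  (mul_le_of_le_one_right (pow_nonneg (edgeAffinity_nonneg a b n) _)
    (pow_le_one₀ (featureAffinity_nonneg α) (featureAffinity_le_one hα hs))).trans
    (pow_le_pow_left₀ (edgeAffinity_nonneg a b n) hr _)

lemma sbmExactCommunityRecovery_of_two_lt {a b : ℝ} (ha : 0 ≤ a) (hb : 0 ≤ b) {K : ℕ → ℕ} {M : ℕ}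
    {α : ℤˣ → Fin M → ℝ} (hα : ∀ s m, 0 < α s m) (hs : ∀ s, ∑ m, α s m = 1)
    (hab : 2 < (√a - √b) ^ 2) : SBMExactCommunityRecovery a b K α := by
  choose xhat hx using fun n => exists_map_estimator a b n (K n) α
  refine ⟨xhat, tendsto_sbmProb_of_bound ha hb hα hs
    (tendsto_sum_choose_mul_exp (c := (√a - √b) ^ 2 / 2) (by linarith)) ?_⟩
  filter_upwards [edgeAffinity_le_exp ha hb, eventually_gt_atTop 0] with n hn hn0
  refine (sbmProb_map_estimator_le ha hb hα hs (hx n) (fun x z => ¬ (z = x ∨ z = -x))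
    (fun k => if k = 0 then 0 else if k = n then 0 else
      Real.exp (-((√a - √b) ^ 2 / 2 * (Real.log n / n))) ^ (k * (n - k))) ?_ ?_).trans
    (le_of_eq ?_)
  · intro k _; split_ifs <;> positivity
  · intro x z hxz
    push Not at hxz
    rw [if_neg (card_diffNodes_pos hxz.1).ne', if_neg (card_diffNodes_lt hxz.2).ne]
    exact affinity_pow_le hα hs hn _ _
  · rw [sum_range_succ_choose_ite n hn0, add_zero]

lemma sbmExactLabelRecovery_of_two_lt {a b : ℝ} (ha : 0 ≤ a) (hb : 0 ≤ b) {K : ℕ → ℕ} {M : ℕ}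
    {α : ℤˣ → Fin M → ℝ} (hα : ∀ s m, 0 < α s m) (hs : ∀ s, ∑ m, α s m = 1)
    (hab : 2 < (√a - √b) ^ 2) (hne : α 1 ≠ α (-1)) (hK : ∀ᶠ n in atTop, 1 ≤ K n) :
    SBMExactLabelRecovery a b K α := by
  choose xhat hx using fun n => exists_map_estimator a b n (K n) α
  have hlim : Tendsto (fun n : ℕ => ∑ k ∈ Finset.Ioo 0 n, (n.choose k : ℝ) *
      Real.exp (-((√a - √b) ^ 2 / 2 * (Real.log n / n))) ^ (k * (n - k)) +
      featureAffinity α ^ n) atTop (𝓝 0) := by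
    simpa using (tendsto_sum_choose_mul_exp (c := (√a - √b) ^ 2 / 2) (by linarith)).add
      (tendsto_pow_atTop_nhds_zero_of_lt_one (featureAffinity_nonneg α)
        (featureAffinity_lt_one hα hs hne))
  refine ⟨xhat, tendsto_sbmProb_of_bound ha hb hα hs hlim ?_⟩
  filter_upwards [edgeAffinity_le_exp ha hb, eventually_gt_atTop 0, hK] with n hn hn0 hKn
  refine (sbmProb_map_estimator_le ha hb hα hs (hx n) (fun x z => ¬ z = x)
    (fun k => if k = 0 then 0 else if k = n then featureAffinity α ^ n else
      Real.exp (-((√a - √b) ^ 2 / 2 * (Real.log n / n))) ^ (k * (n - k))) ?_ ?_).trans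
    (le_of_eq ?_)
  · intro k _
    have := featureAffinity_nonneg α
    split_ifs <;> positivity
  · intro x z hxz
    rw [if_neg (card_diffNodes_pos hxz).ne']
    split_ifs with h
    -- Here `z = -x`, which no graph can tell from `x`; one feature per node already gives `φ ^ n`.
    · rw [h, Nat.sub_self, mul_zero, pow_zero, one_mul]
      exact pow_le_pow_of_le_one (featureAffinity_nonneg α) (featureAffinity_le_one hα hs)
        (Nat.le_mul_of_pos_left n hKn)
    · exact affinity_pow_le hα hs hn _ _
  · rw [sum_range_succ_choose_ite n hn0]

/-! ### Flipping one node -/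

lemma sbmProb_eq_sum (a b : ℝ) (n K : ℕ) [Fintype (SimpleGraph (Fin n))] {M : ℕ}
    (α : ℤˣ → Fin M → ℝ) (S : SBMLabels n → SimpleGraph (Fin n) → SBMSideInfo n K M → Prop)
    [∀ x G y, Decidable (S x G y)] :
    sbmProb a b n K α S = ∑ x : SBMLabels n, ∑ G : SimpleGraph (Fin n),
      ∑ y : SBMSideInfo n K M, if S x G y then sbmJointProb a b α x G y else 0 := by
  unfold sbmProb
  refine Finset.sum_congr rfl fun x _ => Finset.sum_congr (by ext; simp) fun G _ =>
    Finset.sum_congr rfl fun y _ => ?_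
  congr

/-- The labeling `x` with the label of node `i` flipped. -/
def flipNode {n : ℕ} (i : Fin n) (x : SBMLabels n) : SBMLabels n := Function.update x i (-x i)

lemma flipNode_apply {n : ℕ} (i : Fin n) (x : SBMLabels n) (j : Fin n) :
    flipNode i x j = if j = i then -x j else x j := by
  unfold flipNode
  by_cases h : j = i
  · subst h; simp
  · simp [h]

lemma neg_units_ne (s : ℤˣ) : -s ≠ s := by
  rcases Int.units_eq_one_or s with rfl | rfl <;> decide

lemma flipNode_involutive {n : ℕ} (i : Fin n) : Function.Involutive (flipNode i) := by
  intro x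
  ext1 j
  simp only [flipNode_apply]
  split_ifs <;> simp

lemma diffNodes_flipNode {n : ℕ} (i : Fin n) (x : SBMLabels n) :
    diffNodes x (flipNode i x) = {i} := by
  ext j
  rw [mem_diffNodes, flipNode_apply, Finset.mem_singleton]
  split_ifs with h
  · simp [h]
  · simpa using h

lemma diffNodes_flipNode_flipNode {n : ℕ} {i j : Fin n} (hij : i ≠ j) (x : SBMLabels n) :
    diffNodes (flipNode i x) (flipNode j x) = {i, j} := by
  ext k
  rw [mem_diffNodes, flipNode_apply, flipNode_apply, Finset.mem_insert, Finset.mem_singleton]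
  have h1 := neg_units_ne (x k)
  split_ifs with h h' h'
  · exact absurd (h.symm.trans h') hij
  · simp [h]
  · simp [h']
  · simp [h, h']

lemma flipNode_mul_flipNode {n : ℕ} (i : Fin n) (x : SBMLabels n) (e : NodePair n) :
    flipNode i x e.1.1 * flipNode i x e.1.2 =
      if e ∈ cutPairs {i} then -(x e.1.1 * x e.1.2) else x e.1.1 * x e.1.2 := by
  have h := mul_eq_mul_iff_diffNodes x (flipNode i x) e.1.1 e.1.2
  rw [diffNodes_flipNode] at h
  split_ifs with he
  · rw [mem_cutPairs, ← h] at he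
    exact (units_ne_iff _ _).1 (Ne.symm he)
  · rw [mem_cutPairs, not_not, ← h] at he
    exact he.symm

/-- The sign of a pair as a real number: `1` within and `-1` across communities. -/
def pairSign {n : ℕ} (x : SBMLabels n) (e : NodePair n) : ℝ := ((x e.1.1 * x e.1.2 : ℤˣ) : ℤ)

lemma pairSign_flipNode {n : ℕ} (i : Fin n) (x : SBMLabels n) (e : NodePair n) :
    pairSign (flipNode i x) e = if e ∈ cutPairs {i} then -pairSign x e else pairSign x e := by
  unfold pairSign
  rw [flipNode_mul_flipNode]
  split_ifs <;> simp

lemma pairSign_mul_self {n : ℕ} (x : SBMLabels n) (e : NodePair n) :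
    pairSign x e * pairSign x e = 1 := by
  unfold pairSign
  rcases Int.units_eq_one_or (x e.1.1 * x e.1.2) with h | h <;> rw [h] <;> simp

/-- Two distinct pairs through `i` have distinct far ends, so the far end of `e` serves as `u`. -/
lemma exists_mem_cutPairs_notMem {n : ℕ} {i : Fin n} {e f : NodePair n} (he : e ∈ cutPairs {i})
    (hf : f ∈ cutPairs {i}) (hef : e ≠ f) : ∃ u, e ∈ cutPairs {u} ∧ f ∉ cutPairs {u} := by
  obtain ⟨⟨p, q⟩, hpq⟩ := e
  obtain ⟨⟨r, s⟩, hrs⟩ := f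
  simp only [mem_cutPairs, Finset.mem_singleton, not_not] at *
  have h1 : p < q := hpq
  have h2 : r < s := hrs
  have h3 : ¬ (p = r ∧ q = s) := fun h => hef (by obtain ⟨rfl, rfl⟩ := h; rfl)
  by_cases hp : p = i
  · exact ⟨q, by grind⟩
  · exact ⟨p, by grind⟩

/-- Flipping a node that lies on `e` but not on `f` permutes the labelings and reverses the sign of
every summand. -/
lemma sum_pairSign_mul_pairSign {n : ℕ} {i : Fin n} {e f : NodePair n} (he : e ∈ cutPairs {i})
    (hf : f ∈ cutPairs {i}) (hef : e ≠ f) : ∑ x : SBMLabels n, pairSign x e * pairSign x f = 0 := by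
  obtain ⟨u, hu, hu'⟩ := exists_mem_cutPairs_notMem he hf hef
  have h := (flipNode_involutive u).bijective.sum_comp
    (fun x : SBMLabels n => pairSign x e * pairSign x f)
  simp only [pairSign_flipNode, if_pos hu, if_neg hu', neg_mul, Finset.sum_neg_distrib] at h
  linarith

/-! ### Moments of the log-likelihood ratio of a flip -/

/-- The log-likelihood ratio, across versus within communities, of a pair being an edge or not. -/
noncomputable def pairLogRatio (a b : ℝ) (n : ℕ) (c : Bool) : ℝ :=
  Real.log (pairWeight a b n (-1) c / pairWeight a b n 1 c)

/-- The log-likelihood ratio of the graph under the labels with node `i` flipped versus `x`. -/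
noncomputable def flipLogRatio (a b : ℝ) {n : ℕ} (i : Fin n) (x : SBMLabels n)
    (G : SimpleGraph (Fin n)) : ℝ :=
  ∑ e ∈ cutPairs {i}, pairSign x e * pairLogRatio a b n (graphEquivPairs n G e)

lemma pairWeight_mul_exp {a b : ℝ} {n : ℕ} (hW : ∀ s c, 0 < pairWeight a b n s c)
    (s : ℤˣ) (c : Bool) : pairWeight a b n s c * Real.exp (((s : ℤ) : ℝ) * pairLogRatio a b n c) =
      pairWeight a b n (-s) c := by
  unfold pairLogRatio
  rcases Int.units_eq_one_or s with rfl | rfl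
  · have := hW 1 c
    simp only [Units.val_one, Int.cast_one, one_mul]
    rw [Real.exp_log (div_pos (hW _ _) (hW _ _))]
    field_simp
  · have := hW (-1) c
    simp only [Units.val_neg, Units.val_one, Int.cast_neg, Int.cast_one, neg_mul, one_mul, neg_neg]
    rw [Real.exp_neg, Real.exp_log (div_pos (hW _ _) (hW _ _))]
    field_simp

lemma sbmGraphProb_flipNode {a b : ℝ} {n : ℕ} (hW : ∀ s c, 0 < pairWeight a b n s c) (i : Fin n)
    (x : SBMLabels n) (G : SimpleGraph (Fin n)) :
    sbmGraphProb a b (flipNode i x) G =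
      sbmGraphProb a b x G * Real.exp (flipLogRatio a b i x G) := by
  classical
  have h : Real.exp (flipLogRatio a b i x G) = ∏ e, if e ∈ cutPairs {i} then
      Real.exp (pairSign x e * pairLogRatio a b n (graphEquivPairs n G e)) else 1 := by
    rw [flipLogRatio, Real.exp_sum, Finset.prod_ite_mem, Finset.univ_inter]
  rw [sbmGraphProb_eq_prod, sbmGraphProb_eq_prod, h, ← Finset.prod_mul_distrib]
  refine Finset.prod_congr rfl fun e _ => ?_
  rw [flipNode_mul_flipNode]
  split_ifs
  · exact (pairWeight_mul_exp hW _ _).symm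
  · rw [mul_one]

lemma sbmGraphProb_pos {a b : ℝ} {n : ℕ} (hW : ∀ s c, 0 < pairWeight a b n s c)
    (x : SBMLabels n) (G : SimpleGraph (Fin n)) : 0 < sbmGraphProb a b x G := by
  rw [sbmGraphProb_eq_prod]
  exact Finset.prod_pos fun _ _ => hW _ _

/-- Tilting by half the log-ratio gives the geometric mean of the two laws, which reduces the
moments needed below to affinities. -/
lemma graphProb_mul_exp_half {a b : ℝ} {n : ℕ} (hW : ∀ s c, 0 < pairWeight a b n s c) (i : Fin n)
    (x : SBMLabels n) (G : SimpleGraph (Fin n)) :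
    sbmGraphProb a b x G * Real.exp (flipLogRatio a b i x G / 2) =
      √(sbmGraphProb a b x G) * √(sbmGraphProb a b (flipNode i x) G) := by
  have h := (sbmGraphProb_pos hW x G).le
  rw [sbmGraphProb_flipNode hW, Real.sqrt_mul h, ← mul_assoc, Real.mul_self_sqrt h, Real.exp_half]

lemma sum_graphProb_mul_exp_half {a b : ℝ} (ha : 0 ≤ a) (hb : 0 ≤ b) {n : ℕ}
    [Fintype (SimpleGraph (Fin n))] (hW : ∀ s c, 0 < pairWeight a b n s c) (i : Fin n)
    (x : SBMLabels n) :
    ∑ G, sbmGraphProb a b x G * Real.exp (flipLogRatio a b i x G / 2) =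
      edgeAffinity a b n ^ (n - 1) := by
  simp only [graphProb_mul_exp_half hW]
  rw [sum_sqrt_graphProb_mul_sqrt ha hb, diffNodes_flipNode]
  simp

/-- The two flipped labelings differ exactly at `i` and `j`. The pair `{i, j}` is not cut, so `2 *
(n - 2)` pairs remain. -/
lemma sum_graphProb_mul_exp_half_mul_exp_half {a b : ℝ} (ha : 0 ≤ a) (hb : 0 ≤ b) {n : ℕ}
    [Fintype (SimpleGraph (Fin n))] (hW : ∀ s c, 0 < pairWeight a b n s c) {i j : Fin n}
    (hij : i ≠ j) (x : SBMLabels n) :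
    ∑ G, sbmGraphProb a b x G * (Real.exp (flipLogRatio a b i x G / 2) *
      Real.exp (flipLogRatio a b j x G / 2)) = edgeAffinity a b n ^ (2 * (n - 2)) := by
  have h : ∀ G, sbmGraphProb a b x G * (Real.exp (flipLogRatio a b i x G / 2) *
      Real.exp (flipLogRatio a b j x G / 2)) =
      √(sbmGraphProb a b (flipNode i x) G) * √(sbmGraphProb a b (flipNode j x) G) := by
    intro G
    have h := (sbmGraphProb_pos hW x G).le
    rw [sbmGraphProb_flipNode hW, sbmGraphProb_flipNode hW, Real.sqrt_mul h, Real.sqrt_mul h,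
      Real.exp_half, Real.exp_half]
    linear_combination -(√(Real.exp (flipLogRatio a b i x G)) *
      √(Real.exp (flipLogRatio a b j x G))) * Real.mul_self_sqrt h
  simp only [h]
  rw [sum_sqrt_graphProb_mul_sqrt ha hb, diffNodes_flipNode_flipNode hij, Finset.card_pair hij]

/-- The second moment of the log-likelihood ratio of a pair under the measure halfway between the
two edge distributions. -/
noncomputable def pairLogRatioMoment (a b : ℝ) (n : ℕ) : ℝ :=
  ∑ c, √(pairWeight a b n 1 c) * √(pairWeight a b n (-1) c) * pairLogRatio a b n c ^ 2

/-- The correlation of the log-likelihood ratios of two pairs `e`, `f` containing `i`, under the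
measure halfway between the graph distributions before and after flipping `i`. -/
noncomputable def flipCorrelation (a b : ℝ) {n : ℕ} (i : Fin n) (e f : NodePair n) : ℝ :=
  ∏ g ∈ cutPairs {i}, ∑ c, √(pairWeight a b n 1 c) * √(pairWeight a b n (-1) c) *
    ((if g = e then pairLogRatio a b n c else 1) * (if g = f then pairLogRatio a b n c else 1))

/-- On a pair through `i` the geometric mean is symmetric in the two edge laws, so the result does
not depend on `x`. This lets the signs be averaged separately. -/
lemma sum_sqrt_mul_pairLogRatio_mul {a b : ℝ} (ha : 0 ≤ a) (hb : 0 ≤ b) {n : ℕ}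
    [Fintype (SimpleGraph (Fin n))] {i : Fin n} {e f : NodePair n}
    (he : e ∈ cutPairs {i}) (hf : f ∈ cutPairs {i}) (x : SBMLabels n) :
    ∑ G, √(sbmGraphProb a b x G) * √(sbmGraphProb a b (flipNode i x) G) *
      (pairLogRatio a b n (graphEquivPairs n G e) * pairLogRatio a b n (graphEquivPairs n G f)) =
      flipCorrelation a b i e f := by
  classical
  have h : ∀ G, √(sbmGraphProb a b x G) * √(sbmGraphProb a b (flipNode i x) G) *
      (pairLogRatio a b n (graphEquivPairs n G e) * pairLogRatio a b n (graphEquivPairs n G f)) =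
      ∏ g, √(pairWeight a b n (x g.1.1 * x g.1.2) (graphEquivPairs n G g)) *
        √(pairWeight a b n (flipNode i x g.1.1 * flipNode i x g.1.2) (graphEquivPairs n G g)) *
        ((if g = e then pairLogRatio a b n (graphEquivPairs n G g) else 1) *
        (if g = f then pairLogRatio a b n (graphEquivPairs n G g) else 1)) := by
    intro G
    rw [sbmGraphProb_eq_prod, sbmGraphProb_eq_prod,
      sqrt_prod' _ _ fun e => pairWeight_nonneg ha hb n _ _,
      sqrt_prod' _ _ fun e => pairWeight_nonneg ha hb n _ _]
    simp only [Finset.prod_mul_distrib, Finset.prod_ite_eq', Finset.mem_univ, if_true]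
  simp only [h]
  rw [sum_graph_prod_eq_prod_sum (fun g c => √(pairWeight a b n (x g.1.1 * x g.1.2) c) *
        √(pairWeight a b n (flipNode i x g.1.1 * flipNode i x g.1.2) c) *
        ((if g = e then pairLogRatio a b n c else 1) * (if g = f then pairLogRatio a b n c else 1)))]
  unfold flipCorrelation
  rw [← Finset.prod_subset (Finset.subset_univ (cutPairs {i}))]
  · refine Finset.prod_congr rfl fun g hg => Finset.sum_congr rfl fun c _ => ?_
    rw [flipNode_mul_flipNode, if_pos hg]
    rcases Int.units_eq_one_or (x g.1.1 * x g.1.2) with h | h <;> rw [h]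
    rw [neg_neg, mul_comm (√(pairWeight a b n (-1) c))]
  · intro g _ hg
    have h1 : g ≠ e := fun h => hg (h ▸ he)
    have h2 : g ≠ f := fun h => hg (h ▸ hf)
    simp only [h1, h2, if_false, mul_one, flipNode_mul_flipNode, if_neg hg]
    rw [sum_sqrt_pairWeight_mul_sqrt ha hb, if_pos rfl]

/-- The extra factor `edgeAffinity a b n` completes the `n - 2` pairs other than `e` to `n - 1`,
avoiding a division. -/
lemma flipCorrelation_self_mul (a b : ℝ) {n : ℕ} {i : Fin n} {e : NodePair n}
    (he : e ∈ cutPairs {i}) : flipCorrelation a b i e e * edgeAffinity a b n =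
      pairLogRatioMoment a b n * edgeAffinity a b n ^ (n - 1) := by
  classical
  have hcard : (cutPairs ({i} : Finset (Fin n))).card = n - 1 := by rw [card_cutPairs]; simp
  unfold flipCorrelation
  rw [← Finset.mul_prod_erase _ _ he, ← hcard, ← Finset.card_erase_add_one he, pow_succ,
    ← Finset.prod_const, ← mul_assoc]
  congr 2
  · unfold pairLogRatioMoment
    refine Finset.sum_congr rfl fun c _ => ?_
    simp [sq]
  · refine Finset.prod_congr rfl fun g hg => ?_
    simp [(Finset.mem_erase.1 hg).1, edgeAffinity]

/-- Averaging over the uniform labels cancels all cross terms, by `sum_pairSign_mul_pairSign`; only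
the `n - 1` diagonal terms survive. -/
lemma sum_graphProb_mul_exp_half_mul_sq {a b : ℝ} (ha : 0 ≤ a) (hb : 0 ≤ b) {n : ℕ}
    [Fintype (SimpleGraph (Fin n))] (hW : ∀ s c, 0 < pairWeight a b n s c) (i : Fin n) :
    (∑ x, ∑ G, sbmGraphProb a b x G * (Real.exp (flipLogRatio a b i x G / 2) *
      flipLogRatio a b i x G ^ 2)) * edgeAffinity a b n =
      2 ^ n * (n - 1 : ℕ) * pairLogRatioMoment a b n * edgeAffinity a b n ^ (n - 1) := by
  classical
  have hcard : (cutPairs ({i} : Finset (Fin n))).card = n - 1 := by rw [card_cutPairs]; simp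
  have h1 : ∀ x, ∑ G, sbmGraphProb a b x G * (Real.exp (flipLogRatio a b i x G / 2) *
      flipLogRatio a b i x G ^ 2) = ∑ e ∈ cutPairs {i}, ∑ f ∈ cutPairs {i},
        pairSign x e * pairSign x f * flipCorrelation a b i e f := by
    intro x
    calc _ = ∑ G, ∑ e ∈ cutPairs {i}, ∑ f ∈ cutPairs {i}, pairSign x e * pairSign x f *
          (√(sbmGraphProb a b x G) * √(sbmGraphProb a b (flipNode i x) G) *
          (pairLogRatio a b n (graphEquivPairs n G e) *
            pairLogRatio a b n (graphEquivPairs n G f))) := by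
          refine Finset.sum_congr rfl fun G _ => ?_
          rw [← mul_assoc, graphProb_mul_exp_half hW, sq, flipLogRatio, Finset.sum_mul_sum,
            Finset.mul_sum]
          refine Finset.sum_congr rfl fun e _ => ?_
          rw [Finset.mul_sum]
          refine Finset.sum_congr rfl fun f _ => ?_
          ring
      _ = _ := by
          rw [Finset.sum_comm]
          refine Finset.sum_congr rfl fun e he => ?_
          rw [Finset.sum_comm]
          refine Finset.sum_congr rfl fun f hf => ?_
          rw [← Finset.mul_sum, sum_sqrt_mul_pairLogRatio_mul ha hb he hf]
  simp only [h1]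
  rw [Finset.sum_comm, Finset.sum_mul]
  have h2 : ∀ e ∈ cutPairs {i}, (∑ x : SBMLabels n, ∑ f ∈ cutPairs {i},
      pairSign x e * pairSign x f * flipCorrelation a b i e f) * edgeAffinity a b n =
      2 ^ n * (pairLogRatioMoment a b n * edgeAffinity a b n ^ (n - 1)) := by
    intro e he
    rw [Finset.sum_comm, Finset.sum_eq_single_of_mem e he]
    · simp only [pairSign_mul_self, one_mul]
      rw [Finset.sum_const, nsmul_eq_mul, mul_assoc, flipCorrelation_self_mul a b he]
      simp [Finset.card_univ, SBMLabels]
    · intro f hf hfe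
      rw [← Finset.sum_mul, sum_pairSign_mul_pairSign he hf hfe.symm, zero_mul]
  rw [Finset.sum_congr rfl h2, Finset.sum_const, nsmul_eq_mul, hcard]
  ring

/-! ### First and second moment of the truncated statistic -/

open Classical in
/-- The number of nodes `i`, weighted by the square root of the likelihood ratio of flipping `i`,
at which that log-likelihood ratio has absolute value at most `L`. -/
noncomputable def flipStatistic (a b : ℝ) {n : ℕ} (L : ℝ) (x : SBMLabels n)
    (G : SimpleGraph (Fin n)) : ℝ :=
  ∑ i, if |flipLogRatio a b i x G| ≤ L then Real.exp (flipLogRatio a b i x G / 2) else 0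

/-- Chebyshev's inequality under the half-tilted measure: the indicator of `|Λ| ≤ L` is at least `1
- Λ ^ 2 / L ^ 2`, and `hV` with `hρ` ensures that truncation removes at most half of the mass. -/
lemma le_sum_flipStatistic {a b : ℝ} (ha : 0 ≤ a) (hb : 0 ≤ b) {n : ℕ}
    [Fintype (SimpleGraph (Fin n))] (hW : ∀ s c, 0 < pairWeight a b n s c) {L : ℝ} (hL : 0 < L)
    (hρ : 1 / 2 ≤ edgeAffinity a b n) (hV : 4 * (n * pairLogRatioMoment a b n) ≤ L ^ 2) :
    n * edgeAffinity a b n ^ (n - 1) / 2 ≤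
      ∑ x : SBMLabels n, ∑ G, (1 / 2) ^ n * sbmGraphProb a b x G * flipStatistic a b L x G := by
  classical
  set ρ := edgeAffinity a b n with hρ'
  have hV0 : 0 ≤ pairLogRatioMoment a b n := Finset.sum_nonneg fun _ _ => by positivity
  have key : ∀ i : Fin n, ρ ^ (n - 1) / 2 ≤ ∑ x : SBMLabels n, ∑ G,
      (1 / 2) ^ n * sbmGraphProb a b x G *
      (if |flipLogRatio a b i x G| ≤ L then Real.exp (flipLogRatio a b i x G / 2) else 0) := by
    intro i
    have h1 : ∀ x G, (1 / 2) ^ n * (sbmGraphProb a b x G *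
        Real.exp (flipLogRatio a b i x G / 2)) - (1 / 2) ^ n * (sbmGraphProb a b x G *
        (Real.exp (flipLogRatio a b i x G / 2) * flipLogRatio a b i x G ^ 2)) / L ^ 2 ≤
        (1 / 2) ^ n * sbmGraphProb a b x G *
        (if |flipLogRatio a b i x G| ≤ L then Real.exp (flipLogRatio a b i x G / 2) else 0) := by
      intro x G
      have hP := (sbmGraphProb_pos hW x G).le
      have hc : (0 : ℝ) ≤ (1 / 2) ^ n * (sbmGraphProb a b x G *
        Real.exp (flipLogRatio a b i x G / 2)) := by positivity
      have h2 : 1 - flipLogRatio a b i x G ^ 2 / L ^ 2 ≤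
          if |flipLogRatio a b i x G| ≤ L then 1 else 0 := by
        split_ifs with h
        · have : 0 ≤ flipLogRatio a b i x G ^ 2 / L ^ 2 := by positivity
          linarith
        · rw [sub_nonpos, one_le_div (by positivity), ← sq_abs (flipLogRatio a b i x G)]
          exact pow_le_pow_left₀ hL.le (not_le.1 h).le 2
      have h3 := mul_le_mul_of_nonneg_left h2 hc
      refine le_trans (le_of_eq ?_) (h3.trans (le_of_eq ?_))
      · ring
      · split_ifs <;> ring
    refine le_trans ?_ (Finset.sum_le_sum fun x _ => Finset.sum_le_sum fun G _ => h1 x G)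
    simp only [Finset.sum_sub_distrib, ← Finset.sum_div, ← Finset.mul_sum,
      sum_graphProb_mul_exp_half ha hb hW i]
    have h4 := sum_graphProb_mul_exp_half_mul_sq ha hb hW i
    set Q := ∑ x, ∑ G, sbmGraphProb a b x G * (Real.exp (flipLogRatio a b i x G / 2) *
      flipLogRatio a b i x G ^ 2)
    have h2n : (1 / 2 : ℝ) ^ n * 2 ^ n = 1 := by rw [← mul_pow]; norm_num
    have h5 : ∑ x : SBMLabels n, ρ ^ (n - 1) = 2 ^ n * ρ ^ (n - 1) := by
      simp [Finset.card_univ, SBMLabels]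
    have hρp : 0 < ρ ^ (n - 1) := pow_pos (by linarith) _
    have h6 : (1 / 2) ^ n * Q * ρ ≤ ρ * (L ^ 2 * (ρ ^ (n - 1) / 2)) := by
      have hn : ((n - 1 : ℕ) : ℝ) ≤ n := by exact_mod_cast Nat.sub_le n 1
      calc (1 / 2) ^ n * Q * ρ = (1 / 2) ^ n * (Q * ρ) := by ring
        _ = ((n - 1 : ℕ) * pairLogRatioMoment a b n) * ρ ^ (n - 1) := by
          rw [h4]; linear_combination ((n - 1 : ℕ) * pairLogRatioMoment a b n *
            ρ ^ (n - 1)) * h2n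
        _ ≤ (n * pairLogRatioMoment a b n) * ρ ^ (n - 1) := by gcongr
        _ ≤ (L ^ 2 / 4) * ρ ^ (n - 1) := by gcongr; linarith
        _ = (1 / 2) * (L ^ 2 * (ρ ^ (n - 1) / 2)) := by ring
        _ ≤ _ := by gcongr
    have h7 : (1 / 2) ^ n * Q / L ^ 2 ≤ ρ ^ (n - 1) / 2 := by
      rw [div_le_iff₀ (by positivity)]
      have := le_of_mul_le_mul_left ((mul_comm _ _).trans_le h6) (by linarith : 0 < ρ)
      linarith
    rw [h5, ← mul_assoc, h2n]
    linarith
  calc _ = ∑ i : Fin n, ρ ^ (n - 1) / 2 := by simp; ring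
    _ ≤ _ := Finset.sum_le_sum fun i _ => key i
    _ = _ := by
      rw [Finset.sum_comm]
      refine Finset.sum_congr rfl fun x _ => ?_
      rw [Finset.sum_comm]
      refine Finset.sum_congr rfl fun G _ => ?_
      rw [flipStatistic, Finset.mul_sum]

/-- The truncation bounds one factor of each diagonal term by `exp (L / 2)`, for a total of at most
`μ ^ 2`. Off the diagonal, `ρ ^ (2 * (n - 2))` exceeds `ρ ^ (2 * (n - 1))` by a factor `ρ⁻² ≤ 4`. -/
lemma sum_flipStatistic_sq_le {a b : ℝ} (ha : 0 ≤ a) (hb : 0 ≤ b) {n : ℕ} (hn : 2 ≤ n)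
    [Fintype (SimpleGraph (Fin n))] (hW : ∀ s c, 0 < pairWeight a b n s c) {L : ℝ}
    (hρ : 1 / 2 ≤ edgeAffinity a b n)
    (hL : Real.exp (L / 2) ≤ n * edgeAffinity a b n ^ (n - 1)) :
    ∑ x : SBMLabels n, ∑ G, (1 / 2) ^ n * sbmGraphProb a b x G * flipStatistic a b L x G ^ 2 ≤
      5 * (n * edgeAffinity a b n ^ (n - 1)) ^ 2 := by
  classical
  set ρ := edgeAffinity a b n with hρ'
  set h : Fin n → SBMLabels n → SimpleGraph (Fin n) → ℝ := fun i x G =>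
    if |flipLogRatio a b i x G| ≤ L then Real.exp (flipLogRatio a b i x G / 2) else 0 with hh
  have h0 : ∀ i x G, 0 ≤ h i x G := fun i x G => by simp only [hh]; split_ifs <;> positivity
  have h1 : ∀ i x G, h i x G ≤ Real.exp (flipLogRatio a b i x G / 2) := fun i x G => by
    simp only [hh]; split_ifs
    · exact le_rfl
    · positivity
  have h2 : ∀ i x G, h i x G ≤ Real.exp (L / 2) := fun i x G => by
    simp only [hh]; split_ifs with hc
    · exact Real.exp_le_exp.2 (by linarith [(abs_le.1 hc).2])
    · positivity
  have hP := fun x G => (sbmGraphProb_pos hW x G (n := n)).le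
  have diag : ∀ i x, ∑ G, sbmGraphProb a b x G * (h i x G * h i x G) ≤
      Real.exp (L / 2) * ρ ^ (n - 1) := by
    intro i x
    rw [← sum_graphProb_mul_exp_half ha hb hW i x, Finset.mul_sum]
    refine Finset.sum_le_sum fun G _ => ?_
    have := mul_le_mul_of_nonneg_left (mul_le_mul (h1 i x G) (h2 i x G) (h0 i x G)
      (Real.exp_pos _).le) (hP x G)
    linarith
  have off : ∀ i j, i ≠ j → ∀ x, ∑ G, sbmGraphProb a b x G * (h i x G * h j x G) ≤
      4 * (ρ ^ (n - 1)) ^ 2 := by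
    intro i j hij x
    have h3 : ∑ G, sbmGraphProb a b x G * (h i x G * h j x G) ≤ ρ ^ (2 * (n - 2)) := by
      rw [hρ', ← sum_graphProb_mul_exp_half_mul_exp_half ha hb hW hij x]
      exact Finset.sum_le_sum fun G _ => mul_le_mul_of_nonneg_left (mul_le_mul (h1 i x G)
        (h1 j x G) (h0 j x G) (Real.exp_pos _).le) (hP x G)
    refine h3.trans ?_
    obtain ⟨m, rfl⟩ : ∃ m, n = m + 2 := ⟨n - 2, by omega⟩
    rw [Nat.add_sub_cancel, show m + 2 - 1 = m + 1 by omega, ← pow_mul, add_mul, pow_add,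
      mul_comm 2 m]
    have h4 : 0 ≤ ρ ^ (m * 2) := pow_nonneg (by linarith) _
    have h5 : 1 ≤ 4 * ρ ^ (1 * 2) := by rw [one_mul]; nlinarith
    linarith [mul_le_mul_of_nonneg_left h5 h4]
  have h2n : (1 / 2 : ℝ) ^ n * 2 ^ n = 1 := by rw [← mul_pow]; norm_num
  have hx : ∀ x : SBMLabels n, ∑ G, (1 / 2) ^ n * sbmGraphProb a b x G * flipStatistic a b L x G ^ 2 ≤
      (1 / 2) ^ n * (5 * (n * ρ ^ (n - 1)) ^ 2) := by
    intro x
    simp only [mul_assoc, ← Finset.mul_sum]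
    refine mul_le_mul_of_nonneg_left ?_ (by positivity)
    calc _ = ∑ i, ∑ j, ∑ G, sbmGraphProb a b x G * (h i x G * h j x G) := by
          rw [Finset.sum_congr rfl fun i _ => Finset.sum_comm, Finset.sum_comm]
          refine Finset.sum_congr rfl fun G _ => ?_
          rw [flipStatistic, sq, Finset.sum_mul_sum, Finset.mul_sum]
          refine Finset.sum_congr rfl fun i _ => ?_
          rw [Finset.mul_sum]
      _ ≤ ∑ i : Fin n, ∑ j : Fin n, ((if i = j then Real.exp (L / 2) * ρ ^ (n - 1) else 0) +
          4 * (ρ ^ (n - 1)) ^ 2) := by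
          refine Finset.sum_le_sum fun i _ => Finset.sum_le_sum fun j _ => ?_
          split_ifs with hij
          · subst hij
            have : 0 ≤ 4 * (ρ ^ (n - 1)) ^ 2 := by positivity
            linarith [diag i x]
          · rw [zero_add]; exact off i j hij x
      _ = Real.exp (L / 2) * (n * ρ ^ (n - 1)) + 4 * (n * ρ ^ (n - 1)) ^ 2 := by
          simp [Finset.sum_add_distrib]; ring
      _ ≤ _ := by
          have : 0 ≤ n * ρ ^ (n - 1) := (Real.exp_pos _).le.trans hL
          nlinarith [mul_le_mul_of_nonneg_right hL this]
  refine (Finset.sum_le_sum fun x _ => hx x).trans (le_of_eq ?_)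
  rw [Finset.sum_const, nsmul_eq_mul, ← mul_assoc]
  simp [Finset.card_univ, SBMLabels]

/-! ### Failure of every estimator -/

lemma sbmSideProb_le_mul_flipNode {n K M : ℕ} {α : ℤˣ → Fin M → ℝ} (hα : ∀ s m, 0 < α s m) {A : ℝ}
    (hA : ∀ s t m, α s m ≤ A * α t m) (i : Fin n) (x : SBMLabels n) (y : SBMSideInfo n K M) :
    sbmSideProb α x y ≤ A ^ K * sbmSideProb α (flipNode i x) y := by
  classical
  have h : ∀ f : Fin n → ℝ, ∏ j, f j = f i * ∏ j ∈ Finset.univ.erase i, f j :=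
    fun f => (Finset.mul_prod_erase _ _ (Finset.mem_univ i)).symm
  unfold sbmSideProb
  rw [h, h, ← mul_assoc]
  have h1 : ∏ k, α (x i) (y i k) ≤ A ^ K * ∏ k, α (flipNode i x i) (y i k) := by
    calc _ ≤ ∏ k, (A * α (flipNode i x i) (y i k)) :=
          Finset.prod_le_prod (fun k _ => (hα _ _).le) fun k _ => hA _ _ _
      _ = _ := by simp [Finset.prod_mul_distrib]
  have h2 : ∏ j ∈ Finset.univ.erase i, ∏ k, α (flipNode i x j) (y j k) =
      ∏ j ∈ Finset.univ.erase i, ∏ k, α (x j) (y j k) := by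
    refine Finset.prod_congr rfl fun j hj => ?_
    rw [flipNode_apply, if_neg (Finset.mem_erase.1 hj).1]
  rw [h2]
  exact mul_le_mul_of_nonneg_right h1
    (Finset.prod_nonneg fun _ _ => Finset.prod_nonneg fun _ _ => (hα _ _).le)

/-- For `Λ ≥ -L` one has `exp (Λ / 2) ≤ exp Λ * exp (L / 2)`, and `exp Λ` turns the graph law under
`x` into that under the flip. -/
lemma jointProb_mul_flipStatistic_le {a b : ℝ} (ha : 0 ≤ a) (hb : 0 ≤ b) {n K M : ℕ}
    {α : ℤˣ → Fin M → ℝ} (hα : ∀ s m, 0 < α s m) {A : ℝ} (hA : ∀ s t m, α s m ≤ A * α t m)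
    (hA0 : 0 ≤ A) (hW : ∀ s c, 0 < pairWeight a b n s c) (L : ℝ) (x : SBMLabels n)
    (G : SimpleGraph (Fin n)) (y : SBMSideInfo n K M) :
    sbmJointProb a b α x G y * flipStatistic a b L x G ≤
      Real.exp (L / 2) * A ^ K * ∑ i, sbmJointProb a b α (flipNode i x) G y := by
  classical
  rw [flipStatistic, Finset.mul_sum, Finset.mul_sum]
  refine Finset.sum_le_sum fun i _ => ?_
  have hnn : 0 ≤ Real.exp (L / 2) * A ^ K * sbmJointProb a b α (flipNode i x) G y :=
    mul_nonneg (by positivity) (sbmJointProb_nonneg ha hb hα _ _ _)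
  split_ifs with h
  · have h1 : Real.exp (flipLogRatio a b i x G / 2) ≤
        Real.exp (flipLogRatio a b i x G) * Real.exp (L / 2) := by
      rw [← Real.exp_add]
      exact Real.exp_le_exp.2 (by linarith [(abs_le.1 h).1])
    have h2 := sbmSideProb_le_mul_flipNode hα hA i x y
    have hP := (sbmGraphProb_pos hW x G).le
    have hS := sbmSideProb_nonneg hα x y
    have h3 := mul_le_mul h2 h1 (Real.exp_pos _).le (hS.trans h2)
    have h4 := mul_le_mul_of_nonneg_left h3 (mul_nonneg (by positivity : (0:ℝ) ≤ (1 / 2) ^ n) hP)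
    unfold sbmJointProb
    rw [sbmGraphProb_flipNode hW]
    refine le_trans (le_of_eq ?_) (h4.trans (le_of_eq ?_)) <;> ring
  · rw [mul_zero]; exact hnn

lemma flipNode_left_injective {n : ℕ} (x : SBMLabels n) :
    Function.Injective fun i => flipNode i x := by
  intro i j h
  have h1 := diffNodes_flipNode i x
  rw [show flipNode i x = flipNode j x from h, diffNodes_flipNode] at h1
  exact (Finset.singleton_injective h1).symm

lemma flipNode_ne_self {n : ℕ} (i : Fin n) (x : SBMLabels n) : flipNode i x ≠ x := by
  intro h
  have := congrFun h i
  rw [flipNode_apply, if_pos rfl] at this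
  exact neg_units_ne _ this

lemma flipNode_ne_neg {n : ℕ} (hn : 2 ≤ n) (i : Fin n) (x : SBMLabels n) : flipNode i x ≠ -x := by
  intro h
  have : Nontrivial (Fin n) := Fin.nontrivial_iff_two_le.2 hn
  obtain ⟨j, hj⟩ := exists_ne i
  have := congrFun h j
  rw [flipNode_apply, if_neg hj] at this
  exact neg_units_ne _ this.symm

/-- Successful labelings are compared with their neighbours, which are failures. -/
lemma sum_success_mul_flipStatistic_le {a b : ℝ} (ha : 0 ≤ a) (hb : 0 ≤ b) {n K M : ℕ}
    (hn : 2 ≤ n) {α : ℤˣ → Fin M → ℝ} (hα : ∀ s m, 0 < α s m) {A : ℝ}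
    (hA : ∀ s t m, α s m ≤ A * α t m) (hA0 : 0 ≤ A) (hW : ∀ s c, 0 < pairWeight a b n s c)
    (L : ℝ) (G : SimpleGraph (Fin n)) (y : SBMSideInfo n K M) (z : SBMLabels n)
    [∀ x, Decidable (z = x ∨ z = -x)] :
    ∑ x, (if z = x ∨ z = -x then sbmJointProb a b α x G y * flipStatistic a b L x G else 0) ≤
      2 * (Real.exp (L / 2) * A ^ K * ∑ x, if z = x ∨ z = -x then 0 else
        sbmJointProb a b α x G y) := by
  classical
  set F := Real.exp (L / 2) * A ^ K * ∑ x, if z = x ∨ z = -x then 0 else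
        sbmJointProb a b α x G y with hF
  have hJ := fun x => sbmJointProb_nonneg ha hb hα x G y
  have hF0 : 0 ≤ F := mul_nonneg (by positivity)
    (Finset.sum_nonneg fun x _ => by split_ifs <;> [exact le_rfl; exact hJ x])
  have key : ∀ x, (z = x ∨ z = -x) → sbmJointProb a b α x G y * flipStatistic a b L x G ≤ F := by
    intro x hx
    refine (jointProb_mul_flipStatistic_le ha hb hα hA hA0 hW L x G y).trans ?_
    refine mul_le_mul_of_nonneg_left ?_ (by positivity)
    calc ∑ i, sbmJointProb a b α (flipNode i x) G y
        = ∑ i, (fun x' => if z = x' ∨ z = -x' then 0 else sbmJointProb a b α x' G y)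
          (flipNode i x) := by
          refine Finset.sum_congr rfl fun i _ => ?_
          have h1 := flipNode_ne_self i x
          have h2 := flipNode_ne_neg hn i x
          dsimp only
          rw [if_neg]
          rintro (h | h) <;> rcases hx with rfl | hx
          · exact h1 h.symm
          · exact h2 (h.symm.trans hx)
          · exact h2 (by rw [h, neg_neg, ← h])
          · exact h1 (neg_injective (h.symm.trans hx))
      _ = ∑ x' ∈ Finset.univ.image fun i => flipNode i x,
          if z = x' ∨ z = -x' then 0 else sbmJointProb a b α x' G y := by
          rw [Finset.sum_image (flipNode_left_injective x).injOn]
      _ ≤ _ := Finset.sum_le_sum_of_subset_of_nonneg (Finset.subset_univ _) fun x _ _ => by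
          split_ifs <;> [exact le_rfl; exact hJ x]
  -- For a fixed observation only the labelings `z` and `-z` count as successes, hence the factor
  -- `2`.
  calc _ ≤ ∑ x, ((if x = z then F else 0) + if x = -z then F else 0) := by
        refine Finset.sum_le_sum fun x _ => ?_
        by_cases h : z = x ∨ z = -x
        · rw [if_pos h]
          have h1 := key x h
          rcases h with h | h
          · rw [if_pos h.symm]; split_ifs <;> linarith
          · rw [if_pos (show x = -z by rw [h, neg_neg])]; split_ifs <;> linarith
        · rw [if_neg h]; split_ifs <;> positivity
    _ = 2 * F := by
        rw [Finset.sum_add_distrib, Finset.sum_ite_eq', Finset.sum_ite_eq']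
        simp; ring

/-- The second moment method for the failure probability of an arbitrary estimator. -/
lemma le_sbmProb_fail {a b : ℝ} (ha : 0 ≤ a) (hb : 0 ≤ b) {n K M : ℕ}
    (hn : 2 ≤ n) {α : ℤˣ → Fin M → ℝ} (hα : ∀ s m, 0 < α s m) (hs : ∀ s, ∑ m, α s m = 1) {A : ℝ}
    (hA : ∀ s t m, α s m ≤ A * α t m) (hA1 : 1 ≤ A) (hW : ∀ s c, 0 < pairWeight a b n s c)
    {L : ℝ} (hL : 0 < L) (hρ : 1 / 2 ≤ edgeAffinity a b n)
    (hV : 4 * (n * pairLogRatioMoment a b n) ≤ L ^ 2)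
    (hμ : Real.exp (L / 2) * A ^ K ≤ n * edgeAffinity a b n ^ (n - 1))
    (xhat : SBMEstimator n K M) :
    1 / 28 ≤ sbmProb a b n K α (fun x G y => ¬ (xhat G y = x ∨ xhat G y = -x)) := by
  classical
  set μ := n * edgeAffinity a b n ^ (n - 1) with hμ'
  have hA0 : 0 ≤ A := by linarith
  have hB0 : 0 < Real.exp (L / 2) * A ^ K := by positivity
  have hμ0 : 0 < μ := hB0.trans_le hμ
  have hLμ : Real.exp (L / 2) ≤ μ :=
    (le_mul_of_one_le_right (Real.exp_pos _).le (one_le_pow₀ hA1)).trans hμ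
  have h1 := le_sum_flipStatistic ha hb hW hL hρ hV
  have h2 := sum_flipStatistic_sq_le ha hb hn hW hρ hLμ
  rw [← hμ'] at h1 h2
  have marg : ∀ F : SBMLabels n → SimpleGraph (Fin n) → ℝ,
      ∑ x, ∑ G, (1 / 2) ^ n * sbmGraphProb a b x G * F x G =
      ∑ x, ∑ G, ∑ y : SBMSideInfo n K M, sbmJointProb a b α x G y * F x G := by
    intro F
    refine Finset.sum_congr rfl fun x _ => Finset.sum_congr rfl fun G _ => ?_
    rw [← Finset.sum_mul]
    unfold sbmJointProb
    rw [← Finset.mul_sum, sum_sbmSideProb hs, mul_one]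
  set Pf := sbmProb a b n K α (fun x G y => ¬ (xhat G y = x ∨ xhat G y = -x)) with hPf
  have hPf' : Pf = ∑ x : SBMLabels n, ∑ G : SimpleGraph (Fin n), ∑ y : SBMSideInfo n K M,
      if xhat G y = x ∨ xhat G y = -x then 0 else sbmJointProb a b α x G y := by
    rw [hPf, sbmProb_eq_sum]
    simp only [ite_not]
  have hsucc : ∑ x : SBMLabels n, ∑ G : SimpleGraph (Fin n), ∑ y : SBMSideInfo n K M,
      (if xhat G y = x ∨ xhat G y = -x then sbmJointProb a b α x G y * flipStatistic a b L x G
        else 0) ≤ 2 * (μ * Pf) := by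
    have hswap : ∀ f : SBMLabels n → SimpleGraph (Fin n) → SBMSideInfo n K M → ℝ,
        ∑ x, ∑ G, ∑ y, f x G y = ∑ G, ∑ y, ∑ x, f x G y := by
      intro f
      rw [Finset.sum_comm]
      exact Finset.sum_congr rfl fun G _ => Finset.sum_comm
    have hPf0 : 0 ≤ Pf := sbmProb_nonneg ha hb n K hα _
    calc _ ≤ 2 * (Real.exp (L / 2) * A ^ K * Pf) := by
          rw [hPf', hswap, hswap, Finset.mul_sum, Finset.mul_sum]
          refine Finset.sum_le_sum fun G _ => ?_
          rw [Finset.mul_sum, Finset.mul_sum]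
          exact Finset.sum_le_sum fun y _ =>
            sum_success_mul_flipStatistic_le ha hb hn hα hA hA0 hW L G y (xhat G y)
      _ ≤ _ := by gcongr
  have hsplit : ∑ x : SBMLabels n, ∑ G, (1 / 2) ^ n * sbmGraphProb a b x G * flipStatistic a b L x G ≤
      2 * (μ * Pf) + ((5 * μ ^ 2) / (20 * μ) + 5 * μ * Pf) := by
    refine le_trans ?_ (add_le_add hsucc (add_le_add_left
      (div_le_div_of_nonneg_right h2 (by positivity : 0 ≤ 20 * μ)) (5 * μ * Pf)))
    rw [marg, marg (fun x G => flipStatistic a b L x G ^ 2), hPf', Finset.sum_div, Finset.mul_sum,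
      ← Finset.sum_add_distrib, ← Finset.sum_add_distrib]
    refine Finset.sum_le_sum fun x _ => ?_
    rw [Finset.sum_div, Finset.mul_sum, ← Finset.sum_add_distrib, ← Finset.sum_add_distrib]
    refine Finset.sum_le_sum fun G _ => ?_
    rw [Finset.sum_div, Finset.mul_sum, ← Finset.sum_add_distrib, ← Finset.sum_add_distrib]
    refine Finset.sum_le_sum fun y _ => ?_
    have hJ := sbmJointProb_nonneg ha hb hα x G y
    split_ifs
    · have : 0 ≤ sbmJointProb a b α x G y * flipStatistic a b L x G ^ 2 / (20 * μ) := by positivity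
      linarith
    -- The weight `20 * μ` makes the second moment contribute `5 * μ ^ 2 / (20 * μ) = μ / 4`, half
    -- of the lower bound `μ / 2`. The remaining `μ / 4` is at most `(2 + 5) * μ * Pf`, whence `1 /
    -- 28`.
    · have h3 : flipStatistic a b L x G ≤ flipStatistic a b L x G ^ 2 / (20 * μ) + 5 * μ := by
        rw [← sub_nonneg]
        have : flipStatistic a b L x G ^ 2 / (20 * μ) + 5 * μ - flipStatistic a b L x G =
            (flipStatistic a b L x G - 10 * μ) ^ 2 / (20 * μ) := by field_simp; ring
        rw [this]; positivity
      have h4 := mul_le_mul_of_nonneg_left h3 hJ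
      refine h4.trans (le_of_eq ?_)
      ring
  have h5 : 5 * μ ^ 2 / (20 * μ) = μ / 4 := by field_simp; ring
  rw [h5] at hsplit
  have h6 : μ * (1 / 28) ≤ μ * Pf := by linarith
  exact le_of_mul_le_mul_left h6 hμ0

/-! ### Asymptotics of the edge parameters -/

lemma tendsto_log_div_natCast : Tendsto (fun n : ℕ => Real.log n / n) atTop (𝓝 0) :=
  (Real.isLittleO_log_id_atTop.comp_tendsto tendsto_natCast_atTop_atTop).tendsto_div_nhds_zero

lemma eventually_mul_log_div_natCast_lt (C : ℝ) {ε : ℝ} (hε : 0 < ε) :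
    ∀ᶠ n : ℕ in atTop, C * (Real.log n / n) < ε := by
  have h := tendsto_log_div_natCast.const_mul C
  rw [mul_zero] at h
  exact h.eventually (gt_mem_nhds hε)

lemma eventually_log_div_natCast_pos : ∀ᶠ n : ℕ in atTop, 0 < Real.log n / n := by
  filter_upwards [eventually_ge_atTop 2] with n hn
  have : (1 : ℝ) < n := by exact_mod_cast hn
  exact div_pos (Real.log_pos this) (by linarith)

lemma pairWeight_eventually_pos {a b : ℝ} (ha : 0 < a) (hb : 0 < b) :
    ∀ᶠ n : ℕ in atTop, ∀ s c, 0 < pairWeight a b n s c := by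
  filter_upwards [sbmEdgeProb_eventually_eq a, sbmEdgeProb_eventually_eq b,
    eventually_log_div_natCast_pos, eventually_mul_log_div_natCast_lt a one_pos,
    eventually_mul_log_div_natCast_lt b one_pos] with n h1 h2 h3 h4 h5 s c
  rw [mul_div_assoc] at h1 h2
  have h6 := mul_pos ha h3
  have h7 := mul_pos hb h3
  unfold pairWeight
  rw [h1, h2]
  split_ifs <;> linarith

lemma edgeAffinity_le_one {a b : ℝ} (ha : 0 ≤ a) (hb : 0 ≤ b) (n : ℕ) :
    edgeAffinity a b n ≤ 1 := by
  rw [edgeAffinity_eq_one_sub ha hb]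
  have h1 := sq_nonneg (√(sbmEdgeProb a n) - √(sbmEdgeProb b n))
  have h2 := sq_nonneg (√(1 - sbmEdgeProb a n) - √(1 - sbmEdgeProb b n))
  linarith

lemma sq_sqrt_one_sub_sub_le {p q : ℝ} (hp : p ≤ 3 / 4) (hq : q ≤ 3 / 4) :
    (√(1 - p) - √(1 - q)) ^ 2 ≤ (p - q) ^ 2 := by
  have h1 := Real.sq_sqrt (show 0 ≤ 1 - p by linarith)
  have h2 := Real.sq_sqrt (show 0 ≤ 1 - q by linarith)
  have h3 : 1 / 2 ≤ √(1 - p) := Real.le_sqrt_of_sq_le (by linarith)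
  have h4 : 1 / 2 ≤ √(1 - q) := Real.le_sqrt_of_sq_le (by linarith)
  have h5 : (p - q) ^ 2 = (√(1 - p) - √(1 - q)) ^ 2 * (√(1 - p) + √(1 - q)) ^ 2 := by
    have h6 : (√(1 - p) - √(1 - q)) * (√(1 - p) + √(1 - q)) = q - p := by
      linear_combination h1 - h2
    rw [← mul_pow, h6]; ring
  rw [h5]
  exact le_mul_of_one_le_right (sq_nonneg _) (one_le_pow₀ (by linarith))

/-- With `l = log n / n`, the non-edge part of the Hellinger distance and the error of linearizing
the exponential are both of order `l ^ 2`, and the slack `ε * l` absorbs them. -/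
lemma exp_le_edgeAffinity {a b : ℝ} (hb : 0 ≤ b) (hab : b ≤ a) {ε : ℝ} (hε : 0 < ε) :
    ∀ᶠ n : ℕ in atTop,
      Real.exp (-(((√a - √b) ^ 2 / 2 + ε) * (Real.log n / n))) ≤ edgeAffinity a b n := by
  have ha : 0 ≤ a := hb.trans hab
  set t := (√a - √b) ^ 2 / 2 + ε with ht
  have ht0 : 0 < t := by positivity
  filter_upwards [sbmEdgeProb_eventually_eq a, sbmEdgeProb_eventually_eq b,
    eventually_log_div_natCast_pos,
    eventually_mul_log_div_natCast_lt a (show (0 : ℝ) < 3 / 4 by norm_num),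
    eventually_mul_log_div_natCast_lt t one_pos,
    eventually_mul_log_div_natCast_lt (a ^ 2 / 2 + t ^ 2) hε] with n h1 h2 h3 h4 h5 h6
  have h7 := sq_sqrt_sub_sqrt_edgeProb ha hb h1 h2
  rw [edgeAffinity_eq_one_sub ha hb, h7, h1, h2]
  simp only [mul_div_assoc]
  generalize Real.log n / n = l at *
  have hbl : b * l ≤ a * l := by gcongr
  have h8 := sq_sqrt_one_sub_sub_le h4.le (hbl.trans h4.le)
  have h9 : (a * l - b * l) ^ 2 ≤ (a * l) ^ 2 := by
    have : 0 ≤ b * l := by positivity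
    exact pow_le_pow_left₀ (by linarith) (by linarith) 2
  have h10 : |(-(t * l))| ≤ 1 := by
    rw [abs_neg, abs_of_pos (by positivity)]; exact h5.le
  have h11 := (abs_le.1 (Real.abs_exp_sub_one_sub_id_le h10)).2
  have h12 := mul_le_mul_of_nonneg_right h6.le h3.le
  have h13 : t * l = (√a - √b) ^ 2 * l / 2 + ε * l := by rw [ht]; ring
  nlinarith

lemma edgeAffinity_eventually_ge_half {a b : ℝ} (hb : 0 ≤ b) (hab : b ≤ a) :
    ∀ᶠ n : ℕ in atTop, 1 / 2 ≤ edgeAffinity a b n := by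
  filter_upwards [exp_le_edgeAffinity hb hab one_pos,
    eventually_mul_log_div_natCast_lt ((√a - √b) ^ 2 / 2 + 1)
      (show (0 : ℝ) < 1 / 2 by norm_num)] with n h1 h2
  linarith [Real.add_one_le_exp (-(((√a - √b) ^ 2 / 2 + 1) * (Real.log n / n)))]

/-- An edge has weight at most `a * l`, where `l = log n / n`, and a constant log-ratio; a non-edge
has weight at most `1` but a log-ratio of at most `2 * (a * l)`. -/
lemma pairLogRatioMoment_le {a b : ℝ} (hb : 0 < b) (hab : b ≤ a) :
    ∀ᶠ n : ℕ in atTop, n * pairLogRatioMoment a b n ≤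
      a * (Real.log (b / a) ^ 2 + 4) * Real.log n := by
  have ha : 0 < a := hb.trans_le hab
  filter_upwards [sbmEdgeProb_eventually_eq a, sbmEdgeProb_eventually_eq b,
    eventually_log_div_natCast_pos, eventually_gt_atTop 0,
    eventually_mul_log_div_natCast_lt a (show (0 : ℝ) < 1 / 2 by norm_num)] with n h1 h2 h3 h0 h4
  have hn : (0 : ℝ) < n := by exact_mod_cast h0
  rw [mul_div_assoc] at h1 h2
  have hln : Real.log n = n * (Real.log n / n) := by field_simp
  rw [hln]
  generalize Real.log n / n = l at *
  have hbl : b * l ≤ a * l := by gcongr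
  have hal0 : 0 < a * l := by positivity
  have hbl0 : 0 < b * l := by positivity
  have hV : pairLogRatioMoment a b n = √(a * l) * √(b * l) * Real.log (b / a) ^ 2 +
      √(1 - a * l) * √(1 - b * l) * Real.log ((1 - b * l) / (1 - a * l)) ^ 2 := by
    simp [pairLogRatioMoment, pairLogRatio, pairWeight, h1, h2,
      show ((-1 : ℤˣ) = 1) = False by simp, mul_div_mul_right b a h3.ne']
  have t1 : √(a * l) * √(b * l) ≤ a * l := by
    calc _ ≤ √(a * l) * √(a * l) := by gcongr
      _ = a * l := Real.mul_self_sqrt hal0.le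
  have t2 : √(1 - a * l) * √(1 - b * l) ≤ 1 :=
    mul_le_one₀ (Real.sqrt_le_one.2 (by linarith)) (Real.sqrt_nonneg _)
      (Real.sqrt_le_one.2 (by linarith))
  have t3 : 1 ≤ (1 - b * l) / (1 - a * l) := by
    rw [one_le_div (by linarith)]; linarith
  have t4 : Real.log ((1 - b * l) / (1 - a * l)) ≤ 2 * (a * l) := by
    refine (Real.log_le_sub_one_of_pos (by linarith)).trans ?_
    rw [sub_le_iff_le_add, div_le_iff₀ (by linarith)]
    nlinarith
  have t5 : Real.log ((1 - b * l) / (1 - a * l)) ^ 2 ≤ 4 * (a * l) := by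
    calc _ ≤ (2 * (a * l)) ^ 2 := pow_le_pow_left₀ (Real.log_nonneg t3) t4 2
      _ ≤ _ := by nlinarith
  have t6 : pairLogRatioMoment a b n ≤ a * l * Real.log (b / a) ^ 2 + 1 * (4 * (a * l)) := by
    rw [hV]
    gcongr
  calc _ ≤ n * (a * l * Real.log (b / a) ^ 2 + 1 * (4 * (a * l))) := by gcongr
    _ = _ := by ring

/-! ### Impossibility below the threshold and conclusion -/

lemma exists_le_mul_of_pos {M : ℕ} {α : ℤˣ → Fin M → ℝ} (hα : ∀ s m, 0 < α s m) :
    ∃ A : ℝ, 1 ≤ A ∧ ∀ s t m, α s m ≤ A * α t m := by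
  have hnn : ∀ p : ℤˣ × ℤˣ × Fin M, 0 ≤ α p.1 p.2.2 / α p.2.1 p.2.2 := fun p =>
    div_nonneg (hα _ _).le (hα _ _).le
  refine ⟨1 + ∑ p : ℤˣ × ℤˣ × Fin M, α p.1 p.2.2 / α p.2.1 p.2.2,
    le_add_of_nonneg_right (Finset.sum_nonneg fun p _ => hnn p), fun s t m => ?_⟩
  have h := Finset.single_le_sum (fun p _ => hnn p) (Finset.mem_univ (s, t, m))
  rw [← div_le_iff₀ (hα t m)]
  dsimp only at h
  linarith

lemma sbmRecoveryFails_of_lt_two {a b : ℝ} (hb : 0 < b) (hab : b ≤ a) {M : ℕ}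
    {α : ℤˣ → Fin M → ℝ} (hα : ∀ s m, 0 < α s m) (hs : ∀ s, ∑ m, α s m = 1) {K : ℕ → ℕ}
    (hK : (fun n : ℕ => (K n : ℝ)) =o[atTop] (fun n : ℕ => Real.log n))
    (hlt : (√a - √b) ^ 2 < 2) : SBMRecoveryFails a b K α := by
  have ha : 0 < a := hb.trans_le hab
  obtain ⟨A, hA1, hA⟩ := exists_le_mul_of_pos hα
  have hlA : 0 ≤ Real.log A := Real.log_nonneg hA1
  -- Half of the gap to the threshold, so that `c + ε = 1 - ε` and `μ ≥ n ^ ε`. The factors `exp (L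
  -- / 2)` and `A ^ K` each use up `n ^ (ε / 2)`.
  set ε : ℝ := (1 - (√a - √b) ^ 2 / 2) / 2 with hε
  have hε0 : 0 < ε := by rw [hε]; linarith
  have hlog : Tendsto (fun n : ℕ => Real.log n) atTop atTop :=
    Real.tendsto_log_atTop.comp tendsto_natCast_atTop_atTop
  refine ⟨1 / 28, by norm_num, ?_⟩
  filter_upwards [eventually_ge_atTop 2, pairWeight_eventually_pos ha hb,
    edgeAffinity_eventually_ge_half hb.le hab, pairLogRatioMoment_le hb hab,
    exp_le_edgeAffinity hb.le hab hε0,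
    hlog.eventually_ge_atTop (4 * (a * (Real.log (b / a) ^ 2 + 4)) / ε ^ 2),
    -- The summand `1` keeps the denominator positive when `A = 1`.
    hK.def (show 0 < ε / (2 * (Real.log A + 1)) by positivity)] with n hn hW hρ hV hexp hbig hKn
  have hn0 : (0 : ℝ) < n := by exact_mod_cast (by omega : 0 < n)
  have hl : 0 < Real.log n := Real.log_pos (by exact_mod_cast hn)
  refine le_sbmProb_fail ha.le hb.le hn hα hs hA hA1 hW (L := ε * Real.log n) (by positivity) hρ
    ?_ ?_
  · rw [div_le_iff₀ (by positivity)] at hbig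
    nlinarith
  · have hAK : A ^ K n ≤ Real.exp (ε * Real.log n / 2) := by
      rw [Real.norm_of_nonneg (Nat.cast_nonneg _), Real.norm_of_nonneg hl.le] at hKn
      rw [← Real.exp_log (show 0 < A by linarith), ← Real.exp_nat_mul]
      apply Real.exp_le_exp.2
      calc K n * Real.log A ≤ ε / (2 * (Real.log A + 1)) * Real.log n * (Real.log A + 1) := by
            gcongr; linarith
        _ = _ := by field_simp
    calc _ ≤ Real.exp (ε * Real.log n / 2) * Real.exp (ε * Real.log n / 2) := by gcongr
      _ = n * Real.exp (-(((√a - √b) ^ 2 / 2 + ε) * (Real.log n / n))) ^ n := by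
          nth_rewrite 3 [← Real.exp_log hn0]
          rw [← Real.exp_nat_mul, ← Real.exp_add, ← Real.exp_add]
          congr 1
          have h1 : (√a - √b) ^ 2 / 2 + ε = 1 - ε := by rw [hε]; ring
          rw [h1]
          field_simp
          ring
      _ ≤ n * edgeAffinity a b n ^ n := by gcongr
      _ ≤ n * edgeAffinity a b n ^ (n - 1) := by
          gcongr ?_ * ?_
          exact pow_le_pow_of_le_one (edgeAffinity_nonneg a b n)
            (edgeAffinity_le_one ha.le hb.le n) (Nat.sub_le n 1)

theorem theorem6 (a b : ℝ) (hb : 0 < b) (hab : b ≤ a)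
    (M : ℕ) (α : ℤˣ → Fin M → ℝ)
    (hα_pos : ∀ s m, 0 < α s m) (hα_sum : ∀ s, ∑ m, α s m = 1)
    (K : ℕ → ℕ)
    (hK : (fun n : ℕ => (K n : ℝ)) =o[atTop] (fun n : ℕ => Real.log n)) :
    (2 < (√a - √b) ^ 2 → SBMExactCommunityRecovery a b K α) ∧
    (2 < (√a - √b) ^ 2 → α 1 ≠ α (-1) → (∀ᶠ n in atTop, 1 ≤ K n) →
      SBMExactLabelRecovery a b K α) ∧
    ((√a - √b) ^ 2 < 2 → SBMRecoveryFails a b K α) :=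
  ⟨sbmExactCommunityRecovery_of_two_lt (hb.le.trans hab) hb.le hα_pos hα_sum,
    sbmExactLabelRecovery_of_two_lt (hb.le.trans hab) hb.le hα_pos hα_sum,
    sbmRecoveryFails_of_lt_two hb hab hα_pos hα_sum hK⟩
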